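/- Let $n\ge 0$ be an integer. Two subgroups of a group are commensurable if their intersection has finite index in both; a subgroup $K$ of $G$ is near-normal if $K$ and $g^{-1}Kg$ are commensurable for every $g\in G$. A group $\Gamma$ has cohomological dimension $\le d$ if the trivial $\mathbb{Z}\Gamma$-module $\mathbb{Z}$ has a projective resolution of length at most $d$, and is of type $\mathrm{FP}$ if the trivial module $\mathbb{Z}$ has a projective resolution of finite length by finitely generated $\mathbb{Z}\Gamma$-modules. Let $G$ be a finitely generated group of cohomological dimension $\le n+1$. Let $K$ be a near-normal subgroup of infinite index in $G$ such that (i) $K$ is of type $\mathrm{FP}$; (ii) $H^m(K,P)=0$ whenever $P$ is a projective $\mathbb{Z}K$-module and $m\ne n$. Then $G$ is of type $\mathrm{FP}$, and $H^m(G,P)=0$ whenever $P$ is a projective $\mathbb{Z}G$-module and $m\ne n+1$. -/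

import Mathlib

open CategoryTheory

universe u

/-- A subgroup `H` of `G` is near-normal if its commensurator is all of `G`: for every `g : G` the
subgroups `H` and `g H g⁻¹` are commensurable. -/
def Subgroup.IsNearNormal {G : Type u} [Group G] (H : Subgroup G) : Prop :=
  Subgroup.Commensurable.commensurator H = ⊤

/-- `G` has cohomological dimension at most `d` over `k`: the trivial `kG`-module `k` has a
projective resolution `0 → P_d → ⋯ → P_0 → k → 0`. -/
def CohomologicalDimensionLE (k : Type u) [CommRing k] (G : Type u) [Group G] (d : ℕ) : Prop :=
  ∃ P : ProjectiveResolution (Rep.trivial k G k), ∀ i, d < i → Limits.IsZero (P.complex.X i)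

/-- `G` is of type `FP` over `k`: the trivial `kG`-module `k` has a projective resolution of finite
length, all of whose terms are finitely generated `kG`-modules. -/
def IsTypeFP (k : Type u) [CommRing k] (G : Type u) [Group G] : Prop :=
  ∃ P : ProjectiveResolution (Rep.trivial k G k),
    (∀ i, Module.Finite (MonoidAlgebra k G) (P.complex.X i).ρ.asModule) ∧
    ∃ d : ℕ, ∀ i, d < i → Limits.IsZero (P.complex.X i)

/-! Write H^m(G,M) as Ext^m(ℤ,M). The main tool is the class of `G`-modules that are smooth relative
to `K`. By near-normality, permutation modules on the cosets of finite-index subgroups U of `K` are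
smooth, and every smooth module is a quotient of a coproduct of them. By Shapiro's lemma and finite
index, Ext^q(ℤ[G/U],P) vanishes for P projective and q ≠ n. Submodules of smooth modules are smooth,
so dimension shifting gives Ext^q(A,P) = 0 for A smooth and q < n; moreover, an epimorphism from a
smooth module induces an injection on Ext^n(-,P). This settles degrees below n, as ℤ is smooth.

Degree n: as `K` is FP_n, the restriction to `K` of a class in H^n(G,F), F free, is supported on KT
with T a finite subset of the basis. Infinite index and near-normality give g with gKT disjoint from
KT. The class comes from `G`, so its restriction to K ∩ gKg⁻¹ is supported on both sets, hence is
zero. Restriction to this finite-index subgroup of `K` is injective in degree n, by the injection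
above applied to ℤ[G/U] → ℤ.

Degree n+1: Ext^{n+1}(ℤ[G/K],F) = 0, so a class in H^{n+1}(G,F) is the boundary of a class in
Ext^n(I,F), with I the augmentation kernel. I is smooth, and finitely generated because `G` is.
Covering I by finitely many FP_n permutation modules shows that the class involves finitely many
free generators.

Finiteness: the dimension bound makes H^{n+1} right exact, so every class in H^{n+1}(G,M) comes from
a finitely generated module. As H^m(G,F) = 0 for m ≤ n, this property descends to all degrees 1 ≤ m
≤ n+1. In degree 1 it makes a syzygy finitely generated; shifting builds a finite resolution. -/

namespace CategoryTheory.Abelian.Ext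

open Limits

universe w w₁ w₂ v v₁ v₂ u₀ u₁ u₂

/-! ### Dimension shifting for Ext. -/

section Induction

variable {C : Type u₀} [Category.{v} C] [Abelian C]

/-- The short exact sequence `0 ⟶ ker π ⟶ P ⟶ X ⟶ 0` with `P` projective. -/
noncomputable abbrev projectiveCover [EnoughProjectives C] (X : C) : ShortComplex C :=
  ShortComplex.mk (kernel.ι (Projective.π X)) (Projective.π X) (kernel.condition _)

lemma shortExact_kernel_of_epi {X Y : C} (f : X ⟶ Y) [Epi f] :
    (ShortComplex.mk (kernel.ι f) f (kernel.condition f)).ShortExact :=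
  { exact := ShortComplex.exact_of_f_is_kernel _ (kernelIsKernel f)
    mono_f := inferInstance
    epi_g := inferInstance }

variable [HasExt.{w} C]

lemma exists_extClass_comp_eq {S : ShortComplex C} (hS : S.ShortExact) [Projective S.X₂]
    {Y : C} {n : ℕ} (e : Ext S.X₃ Y (n + 1)) :
    ∃ e' : Ext S.X₁ Y n, hS.extClass.comp e' (add_comm 1 n) = e :=
  contravariant_sequence_exact₃ hS Y e (eq_zero_of_projective _) (add_comm 1 n)

/-- Every `Ext`-class is an iterated Yoneda product of classes of short exact sequences. -/
theorem induction_extClass [EnoughProjectives C] {P : ∀ {X Y : C} {n : ℕ}, Ext X Y n → Prop}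
    (mk₀ : ∀ {X Y : C} (f : X ⟶ Y), P (mk₀ f))
    (extClass_comp : ∀ (S : ShortComplex C) (hS : S.ShortExact) {Y : C} {n : ℕ} (e : Ext S.X₁ Y n),
      P e → P (hS.extClass.comp e (add_comm 1 n)))
    {X Y : C} {n : ℕ} (e : Ext X Y n) : P e := by
  induction n generalizing X with
  | zero =>
    obtain ⟨f, rfl⟩ := (mk₀_bijective X Y).2 e
    exact mk₀ f
  | succ n ih =>
    obtain ⟨e', rfl⟩ := exists_extClass_comp_eq
      (shortExact_kernel_of_epi (Projective.π X)) (Y := Y) e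
    exact extClass_comp _ _ _ (ih e')

end Induction

/-! ### Ext under exact functors and adjunctions. -/

section Functors

variable {C : Type u₀} [Category.{v} C] [Abelian C] [HasExt.{w} C]
  {D : Type u₁} [Category.{v₁} D] [Abelian D] [HasExt.{w₁} D]
  {E : Type u₂} [Category.{v₂} E] [Abelian E] [HasExt.{w₂} E]

theorem mapExactFunctor_naturality [EnoughProjectives C] {F F' : C ⥤ D}
    [F.Additive] [PreservesFiniteLimits F] [PreservesFiniteColimits F]
    [F'.Additive] [PreservesFiniteLimits F'] [PreservesFiniteColimits F']
    (τ : F ⟶ F') {X Y : C} {n : ℕ} (e : Ext X Y n) :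
    (e.mapExactFunctor F).comp (mk₀ (τ.app Y)) (add_zero n) =
      (mk₀ (τ.app X)).comp (e.mapExactFunctor F') (zero_add n) := by
  induction e using induction_extClass with
  | mk₀ f => simp [mapExactFunctor_mk₀]
  | extClass_comp S hS e he =>
    rw [mapExactFunctor_comp, mapExactFunctor_comp, comp_assoc_of_third_deg_zero, he,
      ← comp_assoc_of_second_deg_zero, mapExactFunctor_extClass, mapExactFunctor_extClass]
    have := ShortComplex.ShortExact.extClass_naturality (hS.map_of_exact F) (hS.map_of_exact F')
      (S.mapNatTrans τ)
    exact (congr_arg (fun x ↦ Ext.comp x (e.mapExactFunctor F') (add_comm 1 _)) this).trans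
      (comp_assoc _ _ _ _ _ (by omega))

theorem mapExactFunctor_id [EnoughProjectives C] {X Y : C} {n : ℕ} (e : Ext X Y n) :
    e.mapExactFunctor (𝟭 C) = e := by
  induction e using induction_extClass with
  | mk₀ f => exact mapExactFunctor_mk₀ _ _
  | extClass_comp S hS e he =>
    rw [mapExactFunctor_comp, he, mapExactFunctor_extClass]
    rfl

theorem mapExactFunctor_comp_functor [EnoughProjectives C] (F : C ⥤ D) (F' : D ⥤ E)
    [F.Additive] [PreservesFiniteLimits F] [PreservesFiniteColimits F]
    [F'.Additive] [PreservesFiniteLimits F'] [PreservesFiniteColimits F']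
    {X Y : C} {n : ℕ} (e : Ext X Y n) :
    (e.mapExactFunctor F).mapExactFunctor F' = e.mapExactFunctor (F ⋙ F') := by
  induction e using induction_extClass with
  | mk₀ f => simp only [mapExactFunctor_mk₀]; rfl
  | extClass_comp S hS e he =>
    rw [mapExactFunctor_comp, mapExactFunctor_comp, mapExactFunctor_comp, he,
      mapExactFunctor_extClass, mapExactFunctor_extClass]
    exact congr_arg (fun x ↦ Ext.comp x (e.mapExactFunctor (F ⋙ F')) (add_comm 1 _))
      (mapExactFunctor_extClass F' (hS.map_of_exact F))

variable {L : C ⥤ D} {R : D ⥤ C}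
  [L.Additive] [PreservesFiniteLimits L] [PreservesFiniteColimits L]
  [R.Additive] [PreservesFiniteLimits R] [PreservesFiniteColimits R]

theorem counit_comp [EnoughProjectives D] (adj : L ⊣ R) {X Y : D} {n : ℕ} (e : Ext X Y n) :
    (mk₀ (adj.counit.app X)).comp e (zero_add n) =
      ((e.mapExactFunctor R).mapExactFunctor L).comp (mk₀ (adj.counit.app Y)) (add_zero n) := by
  have := mapExactFunctor_naturality adj.counit e
  rw [mapExactFunctor_id, ← mapExactFunctor_comp_functor] at this
  exact this.symm

theorem counit_comp_eq_zero [EnoughProjectives D] (adj : L ⊣ R) {X Y : D} {n : ℕ} (e : Ext X Y n)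
    (he : e.mapExactFunctor R = 0) : (mk₀ (adj.counit.app X)).comp e (zero_add n) = 0 := by
  rw [counit_comp adj, he]
  simp

/-- By the triangle identity, a class is recovered from its image under `R` by composing with the
unit, applying `L` and composing with the counit. This is the half of Shapiro's lemma that is
needed. -/
theorem eq_zero_of_left_adjoint [EnoughProjectives D] (adj : L ⊣ R) {X : C} {Y : D} {n : ℕ}
    (h : ∀ e : Ext X (R.obj Y) n, e = 0) (e : Ext (L.obj X) Y n) : e = 0 := by
  have h1 : (mk₀ (adj.unit.app X)).comp (e.mapExactFunctor R) (zero_add n) = 0 := h _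
  have h2 := congr_arg (mapExactFunctor L) h1
  rw [mapExactFunctor_comp, mapExactFunctor_mk₀, mapExactFunctor_zero] at h2
  have h3 := counit_comp adj e
  have h4 := congr_arg (fun x ↦ (mk₀ (L.map (adj.unit.app X))).comp x (zero_add n)) h3
  beta_reduce at h4
  rw [mk₀_comp_mk₀_assoc, ← comp_assoc_of_third_deg_zero, h2] at h4
  simpa using h4

end Functors

/-! ### Ext out of coproducts. -/

section Sigma

variable {C : Type u₀} [Category.{v} C] [Abelian C]
  {I : Type v} [HasColimitsOfShape (Discrete I) C]

lemma sigmaMap_comp_eq_zero (S : I → ShortComplex C) :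
    (Limits.Sigma.map fun i ↦ (S i).f) ≫ (Limits.Sigma.map fun i ↦ (S i).g) = 0 := by
  ext; simp

variable [HasExactColimitsOfShape (Discrete I) C]

instance mono_sigmaMap {A B : I → C} (f : ∀ i, A i ⟶ B i) [∀ i, Mono (f i)] :
    Mono (Limits.Sigma.map f) := by
  have : Mono (Discrete.natTrans fun X ↦ f X.as : Discrete.functor A ⟶ Discrete.functor B) := by
    have (X : Discrete I) :
        Mono ((Discrete.natTrans fun X ↦ f X.as : Discrete.functor A ⟶ Discrete.functor B).app X) :=
      inferInstanceAs (Mono (f X.as))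
    exact NatTrans.mono_of_mono_app _
  exact inferInstanceAs (Mono (colim.map
    (Discrete.natTrans fun X ↦ f X.as : Discrete.functor A ⟶ Discrete.functor B)))

lemma shortExact_sigma (S : I → ShortComplex C) (hS : ∀ i, (S i).ShortExact) :
    (ShortComplex.mk (Limits.Sigma.map fun i ↦ (S i).f) (Limits.Sigma.map fun i ↦ (S i).g)
      (sigmaMap_comp_eq_zero S)).ShortExact := by
  have (i : I) := (hS i).mono_f
  have (i : I) := (hS i).epi_g
  have hc : IsColimit (CokernelCofork.ofπ (Limits.Sigma.map fun i ↦ (S i).g)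
      (sigmaMap_comp_eq_zero S)) := by
    refine CokernelCofork.IsColimit.ofπ' _ _ fun {Z} k hk ↦
      ⟨Limits.Sigma.desc fun i ↦ (hS i).exact.desc
        (Limits.Sigma.ι (fun i ↦ (S i).X₂) i ≫ k) ?_, ?_⟩
    · have := Limits.Sigma.ι _ i ≫= hk
      simpa using this
    · ext i
      simp [(hS i).exact.g_desc]
  exact
    { exact := ShortComplex.exact_of_g_is_cokernel _ hc
      mono_f := mono_sigmaMap fun i ↦ (S i).f
      epi_g := inferInstanceAs (Epi (Limits.Sigma.map fun i ↦ (S i).g)) }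

variable [HasExt.{w} C] [EnoughProjectives C]

/-- Exactness of coproducts allows dimension shifting on all summands at once. -/
theorem eq_zero_of_sigma {A : I → C} {Y : C} {n : ℕ} (e : Ext (∐ A) Y n)
    (h : ∀ i, (mk₀ (Limits.Sigma.ι A i)).comp e (zero_add n) = 0) : e = 0 := by
  induction n generalizing A with
  | zero =>
    obtain ⟨f, rfl⟩ := (mk₀_bijective _ _).2 e
    simp only [mk₀_comp_mk₀, mk₀_eq_zero_iff] at h ⊢
    ext i
    simp [h i]
  | succ n ih =>
    let S (i : I) : ShortComplex C := projectiveCover (A i)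
    have hS (i : I) : (S i).ShortExact := shortExact_kernel_of_epi _
    have hS' := shortExact_sigma S hS
    have : Projective (∐ fun i ↦ (S i).X₂) := by
      dsimp only [S]
      infer_instance
    obtain ⟨e', rfl⟩ : ∃ e', hS'.extClass.comp e' (add_comm 1 n) = e :=
      exists_extClass_comp_eq hS' e
    have nat (i : I) := ShortComplex.ShortExact.extClass_naturality (hS i) hS'
      { τ₁ := Limits.Sigma.ι (fun i ↦ (S i).X₁) i
        τ₂ := Limits.Sigma.ι (fun i ↦ (S i).X₂) i
        τ₃ := Limits.Sigma.ι (fun i ↦ (S i).X₃) i }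
    dsimp only at nat
    have key (i : I) : ∃ z : Ext (S i).X₂ Y n, (mk₀ (S i).f).comp z (zero_add n) =
        (mk₀ (Limits.Sigma.ι (fun i ↦ (S i).X₁) i)).comp e' (zero_add n) := by
      refine contravariant_sequence_exact₁ (hS i) Y _ (add_comm 1 n) ?_
      rw [← comp_assoc_of_second_deg_zero, nat, comp_assoc _ _ _ _ _ (by omega)]
      exact h i
    choose z hz using key
    obtain ⟨z', hz'⟩ : ∃ z' : Ext (∐ fun i ↦ (S i).X₂) Y n, ∀ i,
        (mk₀ (Limits.Sigma.ι (fun i ↦ (S i).X₂) i)).comp z' (zero_add n) = z i := by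
      cases n with
      | zero =>
        choose g hg using fun i ↦ (mk₀_bijective _ _).2 (z i)
        exact ⟨mk₀ (Limits.Sigma.desc g), fun i ↦ by simp [hg]⟩
      | succ n => exact ⟨0, fun i ↦ by simp [eq_zero_of_projective (z i)]⟩
    -- The shifted class need not vanish on each summand; it only extends over the projective middle
    -- term there. Subtracting the assembled extension makes induction apply and leaves the boundary
    -- unchanged.
    have : e' - (mk₀ (Limits.Sigma.map fun i ↦ (S i).f)).comp z' (zero_add n) = 0 := by
      refine ih _ fun i ↦ ?_
      rw [sub_eq_add_neg, comp_add, comp_neg, mk₀_comp_mk₀_assoc, Limits.Sigma.ι_map,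
        ← mk₀_comp_mk₀_assoc, hz', hz]
      simp
    rw [sub_eq_zero.1 this]
    exact hS'.extClass_comp_assoc z'

end Sigma

end CategoryTheory.Abelian.Ext

/-! ### Exactness of induction, Shapiro's lemma, and group cohomology as Ext. -/

namespace Rep

open Limits Representation

section Instances

variable (k : Type) [CommRing k] (G : Type) [Group G]

instance hasExt : HasExt.{0} (Rep.{0} k G) := hasExt_of_enoughProjectives _

instance hasExactColimitsOfShape_discrete (I : Type) :
    HasExactColimitsOfShape (Discrete I) (Rep.{0} k G) := by
  have : HasExactColimitsOfShape (Discrete I) (ModuleCat.{0} k) := inferInstance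
  have : PreservesColimitsOfShape (Discrete I) (forget₂ (Rep.{0} k G) (ModuleCat.{0} k)) :=
    inferInstance
  have : PreservesFiniteLimits (forget₂ (Rep.{0} k G) (ModuleCat.{0} k)) := inferInstance
  have : ReflectsFiniteLimits (forget₂ (Rep.{0} k G) (ModuleCat.{0} k)) := inferInstance
  exact HasExactColimitsOfShape.domain_of_functor _ (forget₂ (Rep.{0} k G) (ModuleCat.{0} k))

end Instances

section Induction

variable {k : Type} [CommRing k] {G H : Type} [Group G] [Group H] (φ : H →* G)

open Classical in
/-- The value at `a` of the coefficient at `g` of the element `x ⊗ a` of an induced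
representation. -/
noncomputable def indCoeffAux (A : Rep.{0} k H) (g x : G) : A →ₗ[k] A :=
  if h : ∃ s, x = φ s * g then A.ρ h.choose⁻¹ else 0

lemma indCoeffAux_mul (hφ : Function.Injective φ) (A : Rep.{0} k H) (g : G) (s : H) :
    indCoeffAux φ A g (φ s * g) = A.ρ s⁻¹ := by
  have h : ∃ t, φ s * g = φ t * g := ⟨s, rfl⟩
  have hs : h.choose = s := (hφ (mul_right_cancel h.choose_spec)).symm
  rw [indCoeffAux, dif_pos h, hs]

lemma indCoeffAux_of_not (A : Rep.{0} k H) (g x : G) (h : ¬ ∃ s, x = φ s * g) :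
    indCoeffAux φ A g x = 0 := dif_neg h

lemma indCoeffAux_comp (hφ : Function.Injective φ) (A : Rep.{0} k H) (g x : G) (s : H) (a : A) :
    indCoeffAux φ A g (φ s * x) (A.ρ s a) = indCoeffAux φ A g x a := by
  by_cases h : ∃ t, x = φ t * g
  · obtain ⟨t, rfl⟩ := h
    rw [← mul_assoc, ← map_mul, indCoeffAux_mul φ hφ, indCoeffAux_mul φ hφ, mul_inv_rev, map_mul]
    simp
  · rw [indCoeffAux_of_not φ A g x h, indCoeffAux_of_not]
    · simp
    · rintro ⟨t, ht⟩
      exact h ⟨s⁻¹ * t, by simp [mul_assoc, ← ht]⟩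

lemma indCoeffAux_naturality (A B : Rep.{0} k H) (f : A ⟶ B) (g x : G) (a : A) :
    indCoeffAux φ B g x (f.hom a) = f.hom (indCoeffAux φ A g x a) := by
  unfold indCoeffAux
  split_ifs
  · simp [hom_comm_apply]
  · simp

/-- The coefficient at `g` of an element of an induced representation. -/
noncomputable def indCoeff (hφ : Function.Injective φ) (A : Rep.{0} k H) (g : G) :
    IndV φ A.ρ →ₗ[k] A :=
  Coinvariants.lift _ (TensorProduct.lift <| (Finsupp.lift (A →ₗ[k] A) k G (indCoeffAux φ A g)) ∘ₗ
      (MonoidAlgebra.coeffLinearEquiv k).toLinearMap) fun s ↦ by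
    ext x a
    simp [indCoeffAux_comp φ hφ]

lemma indCoeff_mk (hφ : Function.Injective φ) (A : Rep.{0} k H) (g x : G) (a : A) :
    indCoeff φ hφ A g (IndV.mk φ A.ρ x a) = indCoeffAux φ A g x a := by
  simp [indCoeff]

lemma indV_mk_mul (A : Rep.{0} k H) (s : H) (x : G) (a : A) :
    IndV.mk φ A.ρ (φ s * x) (A.ρ s a) = IndV.mk φ A.ρ x a := by
  refine (Submodule.Quotient.eq _).2 ?_
  refine Coinvariants.mem_ker_of_eq s (.single x 1 ⊗ₜ[k] a) _ ?_
  simp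

lemma indMap_mk {A B : Rep.{0} k H} (f : A ⟶ B) (x : G) (a : A) :
    (indMap φ f).hom (IndV.mk φ A.ρ x a) = IndV.mk φ B.ρ x (f.hom a) := by
  simp [indMap]

lemma indCoeff_indMap (hφ : Function.Injective φ) {A B : Rep.{0} k H} (f : A ⟶ B) (g : G)
    (x : IndV φ A.ρ) :
    indCoeff φ hφ B g ((indMap φ f).hom x) = f.hom (indCoeff φ hφ A g x) := by
  have : indCoeff φ hφ B g ∘ₗ (indMap φ f).hom.toLinearMap =
      f.hom.toLinearMap ∘ₗ indCoeff φ hφ A g := by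
    refine IndV.hom_ext _ _ fun h ↦ LinearMap.ext fun a ↦ ?_
    change indCoeff φ hφ B g ((indMap φ f).hom (IndV.mk φ A.ρ h a)) =
      f.hom (indCoeff φ hφ A g (IndV.mk φ A.ρ h a))
    rw [indMap_mk, indCoeff_mk, indCoeff_mk]
    exact indCoeffAux_naturality φ A B f g h a
  exact LinearMap.congr_fun this x

lemma indV_induction {A : Rep.{0} k H} {W : Submodule k (IndV φ A.ρ)}
    (h : ∀ x a, IndV.mk φ A.ρ x a ∈ W) : W = ⊤ := by
  have : W.mkQ = 0 := IndV.hom_ext _ _ fun x ↦ LinearMap.ext fun a ↦ by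
    simpa using h x a
  rw [← W.ker_mkQ, this, LinearMap.ker_zero]

/-- Orbit representatives express `x` as a finite sum, and the coefficient at a representative
isolates one term. Since coefficients commute with `indMap`, induction then preserves monomorphisms.
-/
lemma indV_eq_zero (hφ : Function.Injective φ) (A : Rep.{0} k H) (x : IndV φ A.ρ)
    (hx : ∀ g, indCoeff φ hφ A g x = 0) : x = 0 := by
  let r : Setoid G := MulAction.orbitRel φ.range G
  let Φ : (Quotient r →₀ A) →ₗ[k] IndV φ A.ρ := Finsupp.lsum k fun q ↦ IndV.mk φ A.ρ q.out
  have hΦ : LinearMap.range Φ = ⊤ := by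
    refine indV_induction φ fun g a ↦ ?_
    obtain ⟨⟨_, s, rfl⟩, hs⟩ : (⟦g⟧ : Quotient r).out ∈ MulAction.orbit φ.range g :=
      Quotient.exact (⟦g⟧ : Quotient r).out_eq
    refine ⟨Finsupp.single ⟦g⟧ (A.ρ s a), ?_⟩
    have hs' : φ s * g = (⟦g⟧ : Quotient r).out := hs
    simp only [Φ, Finsupp.lsum_single]
    rw [← hs', indV_mk_mul]
  obtain ⟨ξ, rfl⟩ : x ∈ LinearMap.range Φ := hΦ ▸ Submodule.mem_top
  have : ξ = 0 := by
    ext q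
    have := hx q.out
    simp only [Φ, Finsupp.lsum_apply, Finsupp.sum, map_sum, indCoeff_mk] at this
    rw [Finset.sum_eq_single q] at this
    · have h1 := indCoeffAux_mul φ hφ A q.out 1
      simp only [map_one, one_mul, inv_one] at h1
      rw [h1] at this
      simpa using this
    · intro q' _ hq'
      rw [indCoeffAux_of_not]
      · rfl
      · rintro ⟨s, hs⟩
        apply hq'
        rw [← q.out_eq, ← q'.out_eq]
        exact Quotient.sound ⟨⟨φ s, s, rfl⟩, hs.symm⟩
    · intro hq
      simp [Finsupp.notMem_support_iff.1 hq]
  rw [this, map_zero]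

lemma indMap_mono (hφ : Function.Injective φ) {A B : Rep.{0} k H} (f : A ⟶ B) [Mono f] :
    Mono (indMap φ f) := by
  rw [mono_iff_injective]
  refine (injective_iff_map_eq_zero _).2 fun x hx ↦ indV_eq_zero φ hφ A x fun g ↦ ?_
  refine (injective_iff_map_eq_zero _).1 ((mono_iff_injective f).1 inferInstance) _ ?_
  rw [← indCoeff_indMap φ hφ]
  erw [hx]
  simp

instance indFunctor_additive : (indFunctor.{0} k φ).Additive :=
  (indResAdjunction.{0} k φ).left_adjoint_additive

instance indFunctor_preservesFiniteColimits :
    PreservesFiniteColimits (indFunctor.{0} k φ) := by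
  have := (indResAdjunction.{0} k φ).leftAdjoint_preservesColimits
  infer_instance

theorem indFunctor_preservesFiniteLimits (hφ : Function.Injective φ) :
    PreservesFiniteLimits (indFunctor.{0} k φ) := by
  refine (indFunctor.{0} k φ).preservesFiniteLimits_iff_forall_exact_map_and_mono.2
    fun S hS ↦ ⟨?_, ?_⟩
  · exact ((indFunctor.{0} k φ).preservesFiniteColimits_iff_forall_exact_map_and_epi.1
      inferInstance S hS).1
  · have := hS.mono_f
    exact indMap_mono φ hφ S.f

instance indFunctor_preservesProjectiveObjects :
    (indFunctor.{0} k φ).PreservesProjectiveObjects :=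
  (indFunctor.{0} k φ).preservesProjectiveObjects_of_adjunction_of_preservesEpimorphisms
    (indResAdjunction.{0} k φ)

end Induction

section FiniteIndex

open CategoryTheory.Abelian

variable {k : Type} [CommRing k] {G : Type} [Group G]

/-- For finite index, induction is also right adjoint to restriction. -/
theorem ext_res_eq_zero_of_ind (H : Subgroup G) [H.FiniteIndex] {A : Rep.{0} k G}
    {B : Rep.{0} k H} {q : ℕ} (h : ∀ x : Abelian.Ext A (ind H.subtype B) q, x = 0)
    (x : Abelian.Ext (res H.subtype A) B q) : x = 0 := by
  classical
  have := indFunctor_preservesFiniteLimits (k := k) H.subtype H.subtype_injective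
  exact Abelian.Ext.eq_zero_of_left_adjoint (resIndAdjunction.{0} k H) h x

theorem ext_ind_eq_zero {H : Type} [Group H] {φ : H →* G} (hφ : Function.Injective φ)
    {A : Rep.{0} k H} {B : Rep.{0} k G} {q : ℕ} (h : ∀ x : Abelian.Ext A (res φ B) q, x = 0)
    (x : Abelian.Ext (ind φ A) B q) : x = 0 := by
  have := indFunctor_preservesFiniteLimits (k := k) φ hφ
  exact Abelian.Ext.eq_zero_of_left_adjoint (indResAdjunction.{0} k φ) h x

end FiniteIndex

section Trivial

variable {k : Type} [CommRing k] {G : Type} [Group G]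

open CategoryTheory.Abelian

lemma linearYonedaObj_exactAt_succ_iff {X : Rep.{0} k G} (P : ProjectiveResolution X)
    (A : Rep.{0} k G) (m : ℕ) :
    (P.complex.linearYonedaObj k A).ExactAt (m + 1) ↔
      ∀ f : P.complex.X (m + 1) ⟶ A, P.complex.d (m + 2) (m + 1) ≫ f = 0 →
        ∃ g : P.complex.X m ⟶ A, P.complex.d (m + 1) m ≫ g = f := by
  rw [HomologicalComplex.exactAt_iff' _ m (m + 1) (m + 2) (by simp) (by simp),
    ShortComplex.moduleCat_exact_iff]
  rfl

lemma linearYonedaObj_exactAt_zero_iff {X : Rep.{0} k G} (P : ProjectiveResolution X)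
    (A : Rep.{0} k G) :
    (P.complex.linearYonedaObj k A).ExactAt 0 ↔
      ∀ f : P.complex.X 0 ⟶ A, P.complex.d 1 0 ≫ f = 0 → f = 0 := by
  rw [HomologicalComplex.exactAt_iff' _ 0 0 1 (by simp) (by simp),
    ShortComplex.moduleCat_exact_iff]
  have h0 (x : P.complex.X 0 ⟶ A) : P.complex.d 0 0 ≫ x = 0 := by
    rw [P.complex.shape _ _ (by simp), zero_comp]
  refine forall_congr' fun f ↦ forall_congr' fun _ ↦ ⟨?_, fun h ↦ ⟨0, ?_⟩⟩
  · rintro ⟨g, rfl⟩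
    exact h0 g
  · rw [map_zero, h]
    rfl

theorem isZero_groupCohomology_iff (A : Rep.{0} k G) (m : ℕ) :
    IsZero (groupCohomology A m) ↔ ∀ x : Abelian.Ext (trivial k G k) A m, x = 0 := by
  let P := ProjectiveResolution.of (trivial k G k)
  rw [(groupCohomologyIso A m P).isZero_iff, ← HomologicalComplex.exactAt_iff_isZero_homology]
  cases m with
  | zero =>
    rw [linearYonedaObj_exactAt_zero_iff]
    constructor
    · intro h x
      obtain ⟨f, hf, rfl⟩ := P.extMk_surjective x 1 rfl
      simp [h f hf]
    · intro h f hf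
      have hd : P.exact₀.desc f hf = 0 := by
        rw [← Abelian.Ext.mk₀_eq_zero_iff]
        exact h _
      rw [← P.exact₀.g_desc f hf, hd, comp_zero]
  | succ m =>
    rw [linearYonedaObj_exactAt_succ_iff]
    constructor
    · intro h x
      obtain ⟨f, hf, rfl⟩ := P.extMk_surjective x (m + 2) rfl
      exact (P.extMk_eq_zero_iff f (m + 2) rfl hf m rfl).2 (h f hf)
    · intro h f hf
      exact (P.extMk_eq_zero_iff f (m + 2) rfl hf m rfl).1 (h _)

end Trivial

end Rep

namespace Rep

open Limits Representation

variable {k : Type} [CommRing k] {G : Type} [Group G] {H : Type} [Group H]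

/-! ### Free representations and projections by support. -/

section FreeOn

variable (k G) in
/-- The free representation on `α`, realised on the finitely supported functions on the free
`G`-set `G × α`. -/
noncomputable abbrev freeOn (α : Type) : Rep.{0} k G :=
  Rep.of (X := (G × α) →₀ k)
    { toFun g := Finsupp.lmapDomain k k fun y ↦ (g * y.1, y.2)
      map_one' := by ext; simp
      map_mul' g h := by ext; simp [mul_assoc] }

variable {α : Type}

lemma freeOn_ρ_single (g : G) (y : G × α) (r : k) :
    (freeOn k G α).ρ g (Finsupp.single y r) = Finsupp.single (g * y.1, y.2) r :=
  Finsupp.mapDomain_single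

lemma freeOn_ρ_apply (g : G) (x : (G × α) →₀ k) (y : G × α) :
    (freeOn k G α).ρ g x y = x (g⁻¹ * y.1, y.2) := by
  have : Function.Injective fun y : G × α ↦ (g * y.1, y.2) := fun y z h ↦ by
    simpa [Prod.ext_iff] using h
  have h := Finsupp.mapDomain_apply this x (g⁻¹ * y.1, y.2)
  simpa using h

/-- The morphism out of a free representation with given values on the basis. -/
noncomputable def freeOnLift {A : Rep.{0} k G} (f : α → A) : freeOn k G α ⟶ A :=
  Rep.ofHom (σ := A.ρ) ⟨Finsupp.linearCombination k fun y : G × α ↦ A.ρ y.1 (f y.2), fun g ↦ by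
    refine Finsupp.lhom_ext fun y r ↦ ?_
    simp [Finsupp.mapDomain_single]⟩

lemma freeOnLift_single {A : Rep.{0} k G} (f : α → A) (y : G × α) (r : k) :
    (freeOnLift f).hom (Finsupp.single y r) = r • A.ρ y.1 (f y.2) :=
  Finsupp.linearCombination_single _ _ _

lemma freeOnLift_one {A : Rep.{0} k G} (f : α → A) (a : α) :
    (freeOnLift f).hom (Finsupp.single (1, a) 1) = f a :=
  (freeOnLift_single f (1, a) 1).trans (by simp)

lemma freeOn_hom_ext {A : Rep.{0} k G} {f f' : freeOn k G α ⟶ A}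
    (h : ∀ a, f.hom (Finsupp.single (1, a) 1) = f'.hom (Finsupp.single (1, a) 1)) : f = f' := by
  ext : 2
  refine Finsupp.lhom_ext' fun y ↦ LinearMap.ext_ring ?_
  have e : Finsupp.single y (1 : k) = (freeOn k G α).ρ y.1 (Finsupp.single (1, y.2) 1) := by
    rw [freeOn_ρ_single, mul_one]
  change f.hom (Finsupp.single y 1) = f'.hom (Finsupp.single y 1)
  rw [e, hom_comm_apply, hom_comm_apply, h]

instance freeOn_projective : Projective (freeOn k G α) where
  factors {A B} f e _ := by
    have he := (epi_iff_surjective e).1 inferInstance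
    choose s hs using he
    refine ⟨freeOnLift fun a ↦ s (f.hom (Finsupp.single (1, a) 1)), freeOn_hom_ext fun a ↦ ?_⟩
    exact (congr_arg e.hom (freeOnLift_one _ a)).trans (hs _)

lemma freeOnLift_epi {A : Rep.{0} k G} : Epi (freeOnLift (id : A → A)) := by
  refine (epi_iff_surjective _).2 fun a ↦ ⟨Finsupp.single (1, a) 1, freeOnLift_one _ a⟩

/-- A subset of the free `G`-set `G × α` is invariant under the image of `φ`. -/
def IsInvariant (φ : H →* G) (S : Set (G × α)) : Prop :=
  ∀ (h : H) (y : G × α), (φ h * y.1, y.2) ∈ S ↔ y ∈ S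

open Classical in
/-- The projection of a free representation onto the span of an invariant subset of the basis. -/
noncomputable def filterHom (φ : H →* G) (S : Set (G × α)) (hS : IsInvariant φ S) :
    res φ (freeOn k G α) ⟶ res φ (freeOn k G α) :=
  Rep.ofHom ⟨{ toFun := Finsupp.filter (· ∈ S)
               map_add' := fun _ _ ↦ Finsupp.filter_add
               map_smul' := fun _ _ ↦ Finsupp.filter_smul }, fun h ↦ by
    refine Finsupp.lhom_ext fun y r ↦ ?_
    have := hS h y
    by_cases hy : y ∈ S <;>
      simp_all [Finsupp.mapDomain_single, Finsupp.filter_single_of_pos,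
        Finsupp.filter_single_of_neg]⟩

open Classical in
lemma filterHom_apply (φ : H →* G) (S : Set (G × α)) (hS : IsInvariant φ S)
    (x : (G × α) →₀ k) : (filterHom φ S hS).hom x = x.filter (· ∈ S) := rfl

end FreeOn

/-! ### Finitely generated representations. -/

section FG

/-- A representation is finitely generated. -/
def IsFG (A : Rep.{0} k G) : Prop :=
  ∃ s : Set A, s.Finite ∧
    ∀ W : Submodule k A, (∀ g, ∀ x ∈ W, A.ρ g x ∈ W) → s ⊆ W → W = ⊤

lemma hom_ext_of_generates {A B : Rep.{0} k G} {s : Set A}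
    (hs : ∀ W : Submodule k A, (∀ g, ∀ x ∈ W, A.ρ g x ∈ W) → s ⊆ W → W = ⊤) {f f' : A ⟶ B}
    (h : ∀ a ∈ s, f.hom a = f'.hom a) : f = f' := by
  have := hs (LinearMap.eqLocus f.hom.toLinearMap f'.hom.toLinearMap) (fun g x hx ↦ by
    simp only [LinearMap.mem_eqLocus, IntertwiningMap.toLinearMap_apply] at hx ⊢
    rw [hom_comm_apply, hom_comm_apply, hx]) h
  ext : 2
  exact LinearMap.eqLocus_eq_top.1 this

lemma epi_of_generates {A B : Rep.{0} k G} {s : Set B}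
    (hs : ∀ W : Submodule k B, (∀ g, ∀ x ∈ W, B.ρ g x ∈ W) → s ⊆ W → W = ⊤) {f : A ⟶ B}
    (h : ∀ b ∈ s, ∃ a, f.hom a = b) : Epi f := by
  have := hs (LinearMap.range f.hom.toLinearMap) (by
    rintro g _ ⟨x, rfl⟩
    exact ⟨A.ρ g x, hom_comm_apply f g x⟩) h
  exact (epi_iff_surjective f).2 (LinearMap.range_eq_top.1 this)

lemma IsFG.of_epi {A B : Rep.{0} k G} (hA : IsFG A) (f : A ⟶ B) [Epi f] : IsFG B := by
  obtain ⟨s, hs, h⟩ := hA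
  refine ⟨f.hom '' s, hs.image _, fun W hW hsW ↦ ?_⟩
  have := h (W.comap f.hom.toLinearMap) (fun g x hx ↦ by
    simp only [Submodule.mem_comap, IntertwiningMap.toLinearMap_apply] at hx ⊢
    rw [hom_comm_apply]
    exact hW g _ hx) (fun x hx ↦ hsW ⟨x, hx, rfl⟩)
  rw [eq_top_iff]
  rintro y -
  obtain ⟨x, rfl⟩ := (epi_iff_surjective f).1 inferInstance y
  exact (this ▸ Submodule.mem_top : x ∈ W.comap f.hom.toLinearMap)

lemma exact_iff_apply (S : ShortComplex (Rep.{0} k G)) :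
    S.Exact ↔ ∀ x : S.X₂, S.g.hom x = 0 → ∃ y, S.f.hom y = x := by
  rw [← ShortComplex.exact_map_iff_of_faithful S (forget₂ (Rep.{0} k G) (ModuleCat.{0} k)),
    ShortComplex.moduleCat_exact_iff]
  rfl

lemma IsFG.of_shortExact {S : ShortComplex (Rep.{0} k G)} (hS : S.ShortExact)
    (h₁ : IsFG S.X₁) (h₃ : IsFG S.X₃) : IsFG S.X₂ := by
  obtain ⟨s, hs, h⟩ := h₁
  obtain ⟨t, ht, h'⟩ := h₃
  have := hS.epi_g
  choose σ hσ using (epi_iff_surjective S.g).1 inferInstance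
  refine ⟨S.f.hom '' s ∪ σ '' t, (hs.image _).union (ht.image _), fun W hW hsW ↦ ?_⟩
  have h1 := h (W.comap S.f.hom.toLinearMap) (fun g x hx ↦ by
    simp only [Submodule.mem_comap, IntertwiningMap.toLinearMap_apply] at hx ⊢
    rw [hom_comm_apply]
    exact hW g _ hx) (fun x hx ↦ hsW (Or.inl ⟨x, hx, rfl⟩))
  have h2 := h' (W.map S.g.hom.toLinearMap) (by
    rintro g _ ⟨x, hx, rfl⟩
    exact ⟨S.X₂.ρ g x, hW g x hx, hom_comm_apply S.g g x⟩)
    (fun x hx ↦ ⟨σ x, hsW (Or.inr ⟨x, hx, rfl⟩), hσ x⟩)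
  rw [eq_top_iff]
  rintro x -
  obtain ⟨y, hy, hyx⟩ : S.g.hom x ∈ W.map S.g.hom.toLinearMap := h2 ▸ Submodule.mem_top
  have hyx' : S.g.hom (x - y) = 0 := by
    rw [map_sub, sub_eq_zero]
    exact hyx.symm
  obtain ⟨z, hz⟩ := (exact_iff_apply S).1 hS.exact _ hyx'
  have hz' : z ∈ W.comap S.f.hom.toLinearMap := h1 ▸ Submodule.mem_top
  have : S.f.hom z ∈ W := hz'
  rw [hz] at this
  simpa using add_mem this hy

lemma isFG_ind (φ : H →* G) {A : Rep.{0} k H} (hA : IsFG A) : IsFG (ind φ A) := by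
  obtain ⟨s, hs, h⟩ := hA
  refine ⟨IndV.mk φ A.ρ 1 '' s, hs.image _, fun W hW hsW ↦ indV_induction φ fun x a ↦ ?_⟩
  have h1 := h (W.comap (IndV.mk φ A.ρ 1)) (fun g a ha ↦ by
    have := hW (φ g) _ ha
    rw [of_ρ, ind_mk, one_mul] at this
    have e := indV_mk_mul φ A g⁻¹ 1 (A.ρ g a)
    simp only [mul_one, map_inv, inv_self_apply] at e
    rw [Submodule.mem_comap, ← e]
    exact this) (fun x hx ↦ hsW ⟨x, hx, rfl⟩)
  have h2 : a ∈ W.comap (IndV.mk φ A.ρ 1) := h1 ▸ Submodule.mem_top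
  have := hW x⁻¹ _ h2
  rw [of_ρ, ind_mk, inv_inv, one_mul] at this
  exact this

lemma isFG_res (K : Subgroup G) [K.FiniteIndex] {A : Rep.{0} k G} (hA : IsFG A) :
    IsFG (res K.subtype A) := by
  obtain ⟨s, hs, h⟩ := hA
  let σ : G ⧸ K → G := fun q ↦ q.out⁻¹
  refine ⟨⋃ q : G ⧸ K, A.ρ (σ q) '' s, Set.finite_iUnion fun q ↦ hs.image _,
    fun W hW hsW ↦ ?_⟩
  -- `W` is stable only under `K`; this is its largest `G`-stable submodule.
  let W' : Submodule k A := ⨅ g : G, W.comap (A.ρ g)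
  have hW' : W' = ⊤ := h W' (fun g x hx ↦ by
      simp only [W', Submodule.mem_iInf, Submodule.mem_comap] at hx ⊢
      intro g'
      have := hx (g' * g)
      simpa using this) (fun a ha ↦ by
      simp only [W', Submodule.mem_iInf, SetLike.mem_coe, Submodule.mem_comap]
      intro g
      obtain ⟨u, hu⟩ := QuotientGroup.mk_out_eq_mul K g⁻¹
      have e : g = u * σ (g⁻¹ : G) := by
        simp only [σ, hu]; group
      have := hW u (A.ρ (σ (g⁻¹ : G)) a) (hsW (Set.mem_iUnion.2 ⟨_, a, ha, rfl⟩))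
      rw [e, map_mul]
      exact this)
  rw [eq_top_iff]
  rintro x -
  have hx : x ∈ W' := hW' ▸ Submodule.mem_top
  simp only [W', Submodule.mem_iInf, Submodule.mem_comap] at hx
  simpa using hx 1

lemma isFG_freeOn (α : Type) [Finite α] : IsFG (freeOn k G α) := by
  refine ⟨Set.range fun a ↦ Finsupp.single (1, a) 1, Set.finite_range _, fun W hW hsW ↦ ?_⟩
  rw [eq_top_iff]
  rintro (x : (G × α) →₀ k) -
  induction x using Finsupp.induction_linear with
  | zero => exact W.zero_mem
  | add x y hx hy => exact W.add_mem hx hy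
  | single y r =>
    have e : Finsupp.single y r = r • (freeOn k G α).ρ y.1 (Finsupp.single (1, y.2) 1) := by
      rw [freeOn_ρ_single, mul_one]
      exact (Finsupp.smul_single_one y r).symm
    rw [e]
    exact W.smul_mem _ (hW _ _ (hsW ⟨y.2, rfl⟩))

lemma IsFG.exists_epi {A : Rep.{0} k G} (hA : IsFG A) :
    ∃ (α : Type) (_ : Finite α) (f : freeOn k G α ⟶ A), Epi f := by
  obtain ⟨s, hs, h⟩ := hA
  refine ⟨s, hs, freeOnLift Subtype.val, epi_of_generates h fun b hb ↦
    ⟨Finsupp.single (1, ⟨b, hb⟩) 1, freeOnLift_one _ _⟩⟩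

lemma isFG_iff_finite (A : Rep.{0} k G) :
    IsFG A ↔ Module.Finite (MonoidAlgebra k G) A.ρ.asModule := by
  have key (W : Submodule k A) (hW : ∀ g, ∀ x ∈ W, A.ρ g x ∈ W) :
      ∃ W' : Submodule (MonoidAlgebra k G) A.ρ.asModule,
        ∀ x, A.ρ.asModuleEquiv.symm x ∈ W' ↔ x ∈ W := by
    refine ⟨{ carrier := A.ρ.asModuleEquiv ⁻¹' W
              add_mem' := fun hx hy ↦ by
                simp only [Set.mem_preimage, map_add] at *
                exact W.add_mem hx hy
              zero_mem' := by simp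
              smul_mem' := fun r x hx ↦ ?_ }, fun x ↦ by simp⟩
    simp only [Set.mem_preimage, asModuleEquiv_map_smul] at hx ⊢
    induction r using MonoidAlgebra.induction_on with
    | of g => simpa using hW g _ hx
    | add f f' hf hf' =>
      rw [map_add]
      exact W.add_mem hf hf'
    | smul r f hf =>
      rw [map_smul]
      exact W.smul_mem r hf
  constructor
  · rintro ⟨s, hs, h⟩
    refine ⟨⟨(hs.image (A.ρ.asModuleEquiv.symm : A → A.ρ.asModule)).toFinset, ?_⟩⟩
    let W' : Submodule (MonoidAlgebra k G) A.ρ.asModule :=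
      Submodule.span _ (A.ρ.asModuleEquiv.symm '' s)
    have := h ((W'.restrictScalars k).comap A.ρ.asModuleEquiv.symm.toLinearMap) (fun g x hx ↦ by
      simp only [Submodule.mem_comap, LinearEquiv.coe_coe, Submodule.restrictScalars_mem] at hx ⊢
      rw [asModuleEquiv_symm_map_rho]
      exact W'.smul_mem _ hx) (fun x hx ↦
      have : A.ρ.asModuleEquiv.symm x ∈ W' := Submodule.subset_span ⟨x, hx, rfl⟩
      this)
    rw [Set.Finite.coe_toFinset]
    change W' = ⊤
    rw [eq_top_iff]
    rintro x -
    have hx : A.ρ.asModuleEquiv x ∈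
        (W'.restrictScalars k).comap A.ρ.asModuleEquiv.symm.toLinearMap :=
      this ▸ Submodule.mem_top
    simpa using hx
  · rintro ⟨s, hs⟩
    refine ⟨A.ρ.asModuleEquiv '' s, s.finite_toSet.image _, fun W hW hsW ↦ ?_⟩
    obtain ⟨W', hW'⟩ := key W hW
    have : W' = ⊤ := by
      rw [eq_top_iff, ← hs, Submodule.span_le]
      intro x hx
      have := (hW' (A.ρ.asModuleEquiv x)).2 (hsW ⟨x, hx, rfl⟩)
      simpa using this
    rw [eq_top_iff]
    rintro x -
    exact (hW' x).1 (this ▸ Submodule.mem_top)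

end FG

/-! ### Finiteness type and finite supports. -/

section FPn

/-- `IsFPn n A`: the representation `A` has a partial resolution of length `n` by finitely generated
projectives with finitely generated `n`-th syzygy. -/
def IsFPn : ℕ → Rep.{0} k G → Prop
  | 0, A => IsFG A
  | n + 1, A => ∃ (A' P : Rep.{0} k G) (i : A' ⟶ P) (p : P ⟶ A) (w : i ≫ p = 0),
      (ShortComplex.mk i p w).ShortExact ∧ Projective P ∧ IsFG P ∧ IsFPn n A'

theorem IsFPn.map (F : Rep.{0} k H ⥤ Rep.{0} k G) [F.Additive] [PreservesFiniteLimits F]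
    [PreservesFiniteColimits F] [F.PreservesProjectiveObjects]
    (hF : ∀ A, IsFG A → IsFG (F.obj A)) {n : ℕ} {A : Rep.{0} k H} (hA : IsFPn n A) :
    IsFPn n (F.obj A) := by
  induction n generalizing A with
  | zero => exact hF A hA
  | succ n ih =>
    obtain ⟨A', P, i, p, w, hS, hP, hP', hA'⟩ := hA
    exact ⟨F.obj A', F.obj P, F.map i, F.map p, by rw [← F.map_comp, w, F.map_zero],
      hS.map_of_exact F, F.projective_obj P, hF P hP', ih hA'⟩

theorem IsFPn.ind {φ : H →* G} (hφ : Function.Injective φ) {n : ℕ} {A : Rep.{0} k H}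
    (hA : IsFPn n A) : IsFPn n (ind φ A) := by
  have := indFunctor_preservesFiniteLimits (k := k) φ hφ
  exact hA.map (indFunctor.{0} k φ) fun _ hA ↦ isFG_ind φ hA

theorem IsFPn.res (K : Subgroup G) [K.FiniteIndex] {n : ℕ} {A : Rep.{0} k G}
    (hA : IsFPn n A) : IsFPn n (res K.subtype A) :=
  hA.map (resFunctor.{0} (k := k) K.subtype) fun _ hA ↦ isFG_res K hA

open CategoryTheory.Abelian

/-- Dimension shifting reduces to a homomorphism from a finitely generated syzygy; the images of its
generators involve finitely many basis elements. -/
theorem IsFPn.exists_finite_support (φ : H →* G) (α : Type) {n : ℕ} {A : Rep.{0} k H}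
    (hA : IsFPn n A) (x : Abelian.Ext A (Rep.res φ (freeOn k G α)) n) :
    ∃ T : Set (G × α), T.Finite ∧ ∀ (S : Set (G × α)) (hS : IsInvariant φ S), T ⊆ S →
      x.comp (Ext.mk₀ (filterHom φ S hS)) (add_zero n) = x := by
  induction n generalizing A with
  | zero =>
    obtain ⟨f, rfl⟩ := (Ext.mk₀_bijective _ _).2 x
    obtain ⟨s, hs, h⟩ := hA
    refine ⟨⋃ a ∈ s, {y | (f.hom a : (G × α) →₀ k) y ≠ 0}, hs.biUnion fun a _ ↦
      Finsupp.hasFiniteSupport _, fun S hS hT ↦ ?_⟩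
    rw [Ext.mk₀_comp_mk₀]
    congr 1
    refine hom_ext_of_generates h fun a ha ↦ ?_
    change (filterHom φ S hS).hom (f.hom a) = f.hom a
    classical
    rw [filterHom_apply]
    refine (Finsupp.filter_eq_self_iff _ _).2 fun y hy ↦ hT ?_
    exact Set.mem_iUnion₂.2 ⟨a, ha, hy⟩
  | succ n ih =>
    obtain ⟨A', P, i, p, w, hS, hP, hP', hA'⟩ := hA
    have : Projective (ShortComplex.mk i p w).X₂ := hP
    obtain ⟨x', rfl⟩ := Ext.exists_extClass_comp_eq hS x
    obtain ⟨T, hT, h⟩ := ih hA' x'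
    refine ⟨T, hT, fun S hS' hTS ↦ ?_⟩
    rw [Ext.comp_assoc_of_third_deg_zero, h S hS' hTS]

end FPn

end Rep

/-! ### Near-normal subgroups. -/

section Commensurability

variable {G : Type} [Group G] {K : Subgroup G}

open scoped Pointwise

lemma Subgroup.IsNearNormal.relIndex_conj_ne_zero (hK : K.IsNearNormal) {U : Subgroup G}
    (hU : U.relIndex K ≠ 0) (g : G) : (ConjAct.toConjAct g • U).relIndex K ≠ 0 := by
  have hg : g ∈ Subgroup.Commensurable.commensurator K := hK ▸ Subgroup.mem_top g
  rw [Subgroup.Commensurable.commensurator_mem_iff] at hg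
  refine Subgroup.relIndex_ne_zero_trans (K := ConjAct.toConjAct g • K) ?_ hg.1
  rwa [Subgroup.relIndex_pointwise_smul]

lemma Subgroup.IsNearNormal.finite_orbit (hK : K.IsNearNormal) (x : G ⧸ K) :
    (MulAction.orbit K x).Finite := by
  obtain ⟨g, rfl⟩ := QuotientGroup.mk_surjective x
  refine Set.finite_of_ncard_ne_zero ?_
  rw [← MulAction.index_stabilizer]
  have h := hK.relIndex_conj_ne_zero (U := K) (by simp) g
  have : MulAction.stabilizer K (g : G ⧸ K) = (ConjAct.toConjAct g • K).subgroupOf K := by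
    ext k
    rw [MulAction.mem_stabilizer_iff, Subgroup.mem_subgroupOf,
      Subgroup.mem_pointwise_smul_iff_inv_smul_mem, ← ConjAct.toConjAct_inv,
      ConjAct.toConjAct_smul, eq_comm]
    change ((g : G) : G ⧸ K) = (((k : G) * g : G) : G ⧸ K) ↔ _
    rw [QuotientGroup.eq, inv_inv, mul_assoc]
  rw [this]
  exact h

/-- Otherwise `G` is a finite union of double cosets K z y⁻¹ K, each a finite union of left cosets
of `K` by near-normality, contradicting infinite index. -/
lemma Subgroup.IsNearNormal.exists_disjoint_translate (hK : K.IsNearNormal)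
    (hindex : ¬ K.FiniteIndex) {α : Type} {T : Set (G × α)} (hT : T.Finite) :
    ∃ g : G, ∀ y ∈ T, ∀ z ∈ T, ∀ a b : K, g * (a * y.1) ≠ b * z.1 := by
  by_contra! h
  refine hindex (@Subgroup.finiteIndex_of_finite_quotient _ _ K ?_)
  have : (⋃ y ∈ T, ⋃ z ∈ T, MulAction.orbit K ((z.1 * y.1⁻¹ : G) : G ⧸ K)) = Set.univ := by
    rw [Set.eq_univ_iff_forall]
    intro x
    obtain ⟨g, rfl⟩ := QuotientGroup.mk_surjective x
    obtain ⟨y, hy, z, hz, a, b, hab⟩ := h g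
    refine Set.mem_iUnion₂.2 ⟨y, hy, Set.mem_iUnion₂.2 ⟨z, hz, b, ?_⟩⟩
    change (((b : G) * (z.1 * y.1⁻¹) : G) : G ⧸ K) = (g : G ⧸ K)
    rw [QuotientGroup.eq]
    have : (b * (z.1 * y.1⁻¹) : G)⁻¹ * g = (a : G)⁻¹ := by
      rw [← mul_assoc, ← hab]
      group
    rw [this]
    exact K.inv_mem a.2
  rw [← Set.finite_univ_iff, ← this]
  exact hT.biUnion fun y _ ↦ hT.biUnion fun z _ ↦ hK.finite_orbit _

end Commensurability

namespace Rep

open Limits Representation CategoryTheory.Abelian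

variable {k : Type} [CommRing k] {G : Type} [Group G]

/-! ### Smooth representations and their permutation covers. -/

section Smooth

/-- A representation of `G` is smooth relative to `K` if every vector is fixed by a subgroup that
meets `K` in a subgroup of finite index. -/
def IsSmooth (K : Subgroup G) (A : Rep.{0} k G) : Prop :=
  ∀ a : A, ∃ U : Subgroup G, U.relIndex K ≠ 0 ∧ ∀ u ∈ U, A.ρ u a = a

variable {K : Subgroup G}

/-- The submodule of vectors fixed by a subgroup that meets `K` in a subgroup of finite index. -/
def smoothPart (K : Subgroup G) (A : Rep.{0} k G) : Submodule k A where
  carrier := {a | ∃ U : Subgroup G, U.relIndex K ≠ 0 ∧ ∀ u ∈ U, A.ρ u a = a}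
  zero_mem' := ⟨⊤, by simp, by simp⟩
  add_mem' := by
    rintro a b ⟨U, hU, ha⟩ ⟨V, hV, hb⟩
    refine ⟨U ⊓ V, Subgroup.relIndex_inf_ne_zero hU hV, fun u hu ↦ ?_⟩
    rw [map_add, ha u hu.1, hb u hu.2]
  smul_mem' := by
    rintro r a ⟨U, hU, ha⟩
    exact ⟨U, hU, fun u hu ↦ by rw [map_smul, ha u hu]⟩

lemma isSmooth_iff (A : Rep.{0} k G) : IsSmooth K A ↔ smoothPart K A = ⊤ := by
  rw [eq_top_iff]
  exact ⟨fun h a _ ↦ h a, fun h a ↦ h (Submodule.mem_top (x := a))⟩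

open scoped Pointwise in
lemma smoothPart_invariant (hK : K.IsNearNormal) (A : Rep.{0} k G) (g : G) (a : A)
    (ha : a ∈ smoothPart K A) : A.ρ g a ∈ smoothPart K A := by
  obtain ⟨U, hU, ha⟩ := ha
  refine ⟨ConjAct.toConjAct g • U, hK.relIndex_conj_ne_zero hU g, fun u hu ↦ ?_⟩
  rw [Subgroup.mem_pointwise_smul_iff_inv_smul_mem, ← ConjAct.toConjAct_inv,
      ConjAct.toConjAct_smul, inv_inv] at hu
  have := congr_arg (A.ρ g) (ha _ hu)
  simpa [← Module.End.mul_apply, ← map_mul, mul_assoc] using this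

lemma IsSmooth.of_mono {A B : Rep.{0} k G} (hB : IsSmooth K B) (f : A ⟶ B) [Mono f] :
    IsSmooth K A := fun a ↦ by
  obtain ⟨U, hU, h⟩ := hB (f.hom a)
  refine ⟨U, hU, fun u hu ↦ (mono_iff_injective f).1 inferInstance ?_⟩
  rw [hom_comm_apply, h u hu]

/-- Near-normality makes the smooth part a subrepresentation, and the quotient by it kills every
summand. -/
lemma isSmooth_sigma (hK : K.IsNearNormal) {I : Type} (A : I → Rep.{0} k G)
    (hA : ∀ i, IsSmooth K (A i)) : IsSmooth K (∐ A) := by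
  rw [isSmooth_iff]
  let q := mkQ (∐ A) (smoothPart K (∐ A)) (fun g a ha ↦ smoothPart_invariant hK _ g a ha)
  have hq : q = 0 := by
    refine Limits.Sigma.hom_ext _ _ fun i ↦ ?_
    ext a
    refine (Submodule.Quotient.mk_eq_zero _).2 ?_
    obtain ⟨U, hU, h⟩ := hA i a
    refine ⟨U, hU, fun u hu ↦ ?_⟩
    change (∐ A).ρ u ((Limits.Sigma.ι A i).hom a) = (Limits.Sigma.ι A i).hom a
    rw [← hom_comm_apply, h u hu]
  rw [eq_top_iff]
  rintro a -
  exact (Submodule.Quotient.mk_eq_zero _).1 (congr_arg (fun f ↦ f.hom a) hq)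

lemma isSmooth_trivial : IsSmooth K (trivial k G k) := fun _ ↦ ⟨⊤, by simp, fun _ _ ↦ rfl⟩

variable (k) in
/-- The permutation representation on the cosets of a subgroup `U` of a subgroup `K` of `G`, as a
representation induced from the trivial one. -/
noncomputable abbrev indTrivial (K : Subgroup G) (U : Subgroup K) : Rep.{0} k G :=
  ind (K.subtype.comp U.subtype) (res (K.subtype.comp U.subtype) (trivial k G k))

lemma subtype_comp_subtype_injective (U : Subgroup K) :
    Function.Injective (K.subtype.comp U.subtype) :=
  K.subtype_injective.comp U.subtype_injective

lemma isSmooth_indTrivial (hK : K.IsNearNormal) (U : Subgroup K) [U.FiniteIndex] :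
    IsSmooth K (indTrivial k K U) := by
  rw [isSmooth_iff]
  refine indV_induction _ fun x a ↦ ?_
  have h1 : IndV.mk (K.subtype.comp U.subtype)
      (res (K.subtype.comp U.subtype) (trivial k G k)).ρ 1 a ∈
      smoothPart K (indTrivial k K U) := by
    refine ⟨U.map K.subtype, ?_, ?_⟩
    · rw [Subgroup.relIndex, Subgroup.subgroupOf, Subgroup.comap_map_eq_self_of_injective
        K.subtype_injective]
      exact Subgroup.FiniteIndex.index_ne_zero
    · rintro _ ⟨u, hu, rfl⟩
      rw [of_ρ, ind_mk, one_mul]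
      have := indV_mk_mul (K.subtype.comp U.subtype)
        (res (K.subtype.comp U.subtype) (trivial k G k)) ⟨u, hu⟩⁻¹ 1 a
      rw [mul_one, map_inv] at this
      exact this
  have := smoothPart_invariant hK _ x⁻¹ _ h1
  rw [of_ρ, ind_mk, inv_inv, one_mul] at this
  exact this

/-- The morphism from an induced trivial representation given by a fixed vector. -/
noncomputable def indTrivialLift (U : Subgroup K) {A : Rep.{0} k G} (a : A)
    (ha : ∀ u ∈ U, A.ρ u a = a) : indTrivial k K U ⟶ A :=
  (indResHomEquiv.{0} (K.subtype.comp U.subtype) _ A).symm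
    (Rep.ofHom ⟨LinearMap.toSpanSingleton k A a, fun u ↦ by
      ext
      have := ha u u.2
      simpa using this.symm⟩)

lemma indTrivialLift_mk (U : Subgroup K) {A : Rep.{0} k G} (a : A)
    (ha : ∀ u ∈ U, A.ρ u a = a) :
    (indTrivialLift U a ha).hom (IndV.mk _ _ 1 (1 : k)) = a := by
  have := (indResHomEquiv.{0} (K.subtype.comp U.subtype) _ A).apply_symm_apply
    (Rep.ofHom ⟨LinearMap.toSpanSingleton k A a, fun u ↦ by
      ext
      have := ha u u.2
      simpa using this.symm⟩ : res (K.subtype.comp U.subtype) (trivial k G k) ⟶ _)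
  have h2 := congr_arg (fun f ↦ f.hom (1 : k)) this
  refine Eq.trans h2 ?_
  exact one_smul k a

/-- A smooth representation generated by `s` is covered by a coproduct, indexed by `s`, of
representations induced from trivial ones. -/
lemma IsSmooth.exists_cover {A : Rep.{0} k G} (hA : IsSmooth K A) {s : Set A}
    (hs : ∀ W : Submodule k A, (∀ g, ∀ x ∈ W, A.ρ g x ∈ W) → s ⊆ W → W = ⊤) :
    ∃ (U : s → Subgroup K) (_ : ∀ a, (U a).FiniteIndex)
      (f : (∐ fun a ↦ indTrivial k K (U a)) ⟶ A), Epi f := by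
  choose U hU h using hA
  refine ⟨fun a ↦ (U a).subgroupOf K, fun a ↦ ⟨hU a⟩,
    Limits.Sigma.desc fun a ↦ indTrivialLift _ (a : A) fun u hu ↦ h a u hu,
    epi_of_generates hs fun a ha ↦
      ⟨(Limits.Sigma.ι (fun a : s ↦ indTrivial k K ((U a).subgroupOf K)) ⟨a, ha⟩).hom
        (IndV.mk _ _ 1 (1 : k)), ?_⟩⟩
  have := Limits.Sigma.ι_desc (fun a : s ↦ indTrivialLift ((U a).subgroupOf K) (a : A)
    fun u hu ↦ h a u hu) ⟨a, ha⟩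
  exact (congr_arg (fun f ↦ f.hom (IndV.mk _ _ 1 (1 : k))) this).trans (indTrivialLift_mk _ _ _)

end Smooth

end Rep

namespace CategoryTheory.Abelian.Ext

open Limits

universe w v u₀

variable {C : Type u₀} [Category.{v} C] [Abelian C] [HasExt.{w} C]

lemma eq_zero_of_mk₀_comp_eq_zero {X Y Z : C} (f : X ⟶ Y) [Epi f] {m : ℕ} (x : Ext Y Z m)
    (hx : (mk₀ f).comp x (zero_add m) = 0)
    (h : ∀ q, q + 1 = m → ∀ y : Ext (kernel f) Z q, y = 0) : x = 0 := by
  cases m with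
  | zero =>
    obtain ⟨g, rfl⟩ := (mk₀_bijective _ _).2 x
    rw [mk₀_comp_mk₀, mk₀_eq_zero_iff] at hx
    rw [mk₀_eq_zero_iff, ← cancel_epi f, hx, Limits.comp_zero]
  | succ q =>
    obtain ⟨y, rfl⟩ := contravariant_sequence_exact₃ (shortExact_kernel_of_epi f) Z x hx
      (add_comm 1 q)
    rw [h q rfl y, comp_zero]

universe v₁ v₂ u₁ u₂ w₁ w₂

/-- In the application `R` restricts to `K`, `F` and `F'` restrict further along conjugation and
inclusion, and `τ` is the action of g. Naturality moves one copy of `p` across `τ`, so the class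
factors through the zero composite in `h`. -/
lemma mapExactFunctor_eq_zero_of_natTrans [EnoughProjectives C]
    {D : Type u₁} [Category.{v₁} D] [Abelian D] [HasExt.{w₁} D]
    {E : Type u₂} [Category.{v₂} E] [Abelian E] [HasExt.{w₂} E]
    {R : C ⥤ D} [R.Additive] [PreservesFiniteLimits R] [PreservesFiniteColimits R]
    {F F' : D ⥤ E} [F.Additive] [PreservesFiniteLimits F] [PreservesFiniteColimits F]
    [F'.Additive] [PreservesFiniteLimits F'] [PreservesFiniteColimits F']
    (τ : R ⋙ F ⟶ R ⋙ F') {X Y : C} {n : ℕ} (x : Ext X Y n) (p : R.obj Y ⟶ R.obj Y)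
    (hp : (x.mapExactFunctor R).comp (mk₀ p) (add_zero n) = x.mapExactFunctor R)
    (σ : (R ⋙ F').obj X ⟶ (R ⋙ F).obj X) (hσ : σ ≫ τ.app X = 𝟙 _)
    (h : F.map p ≫ τ.app Y ≫ F'.map p = 0) : x.mapExactFunctor (R ⋙ F') = 0 := by
  have nat := mapExactFunctor_naturality τ x
  have h1 : (x.mapExactFunctor (R ⋙ F)).comp (mk₀ (F.map p)) (add_zero n) =
      x.mapExactFunctor (R ⋙ F) := by
    rw [← mapExactFunctor_comp_functor]
    conv_rhs => rw [← hp]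
    rw [mapExactFunctor_comp, mapExactFunctor_mk₀]
  have h2 : (x.mapExactFunctor (R ⋙ F')).comp (mk₀ (F'.map p)) (add_zero n) =
      x.mapExactFunctor (R ⋙ F') := by
    rw [← mapExactFunctor_comp_functor]
    conv_rhs => rw [← hp]
    rw [mapExactFunctor_comp, mapExactFunctor_mk₀]
  have h3 : (mk₀ (τ.app X)).comp (x.mapExactFunctor (R ⋙ F')) (zero_add n) = 0 := by
    rw [← h2, ← comp_assoc_of_third_deg_zero, ← nat, ← h1, comp_assoc_of_third_deg_zero,
      comp_assoc_of_third_deg_zero, mk₀_comp_mk₀, mk₀_comp_mk₀]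
    have h' : F.map p ≫ τ.app Y ≫ F'.map p = 0 := h
    erw [h']
    simp
  have h4 := congr_arg (fun z ↦ (mk₀ σ).comp z (zero_add n)) h3
  beta_reduce at h4
  rwa [mk₀_comp_mk₀_assoc, hσ, comp_zero, mk₀_id_comp] at h4

end CategoryTheory.Abelian.Ext

namespace Rep

open Limits Representation CategoryTheory.Abelian

variable {k : Type} [CommRing k] {G : Type} [Group G]

/-! ### Vanishing below degree n, and injectivity in degree n. -/

section Vanishing

variable {K : Subgroup G} {n : ℕ}

variable (k K n) in
/-- The cohomology of `K` with coefficients in projectives is concentrated in degree `n`. -/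
def ProjectiveCohomologyConcentrated : Prop :=
  ∀ P : Rep.{0} k K, Projective P → ∀ m, m ≠ n → ∀ x : Abelian.Ext (trivial k K k) P m, x = 0

/-- Shapiro's lemma passes to `U`, and finite index then passes to `K` with coefficients induced
from `U`, which remain projective. -/
lemma ProjectiveCohomologyConcentrated.ext_indTrivial_eq_zero
    (h : ProjectiveCohomologyConcentrated k K n) (U : Subgroup K) [U.FiniteIndex]
    {P : Rep.{0} k G} [Projective P] {q : ℕ} (hq : q ≠ n)
    (x : Abelian.Ext (indTrivial k K U) P q) : x = 0 := by
  refine ext_ind_eq_zero (subtype_comp_subtype_injective U) (fun x ↦ ?_) x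
  have h1 : Projective (res K.subtype P) := (resFunctor.{0} (k := k) K.subtype).projective_obj P
  have h2 : Projective (res U.subtype (res K.subtype P)) :=
    (resFunctor.{0} (k := k) U.subtype).projective_obj _
  have h3 : Projective (ind U.subtype (res U.subtype (res K.subtype P))) :=
    (indFunctor.{0} k U.subtype).projective_obj _
  exact ext_res_eq_zero_of_ind U (A := trivial k K k) (fun x ↦ h _ h3 _ hq x) x

lemma ProjectiveCohomologyConcentrated.ext_eq_zero_of_isSmooth
    (h : ProjectiveCohomologyConcentrated k K n) (hK : K.IsNearNormal)
    {A : Rep.{0} k G} (hA : IsSmooth K A)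
    {P : Rep.{0} k G} [Projective P] {q : ℕ} (hq : q < n) (x : Abelian.Ext A P q) : x = 0 := by
  induction q generalizing A with
  | zero =>
    obtain ⟨U, hU, f, hf⟩ := hA.exists_cover (s := Set.univ) fun _ _ h ↦
      SetLike.coe_injective (Set.univ_subset_iff.1 h)
    exact Ext.eq_zero_of_mk₀_comp_eq_zero f x (Ext.eq_zero_of_sigma _ fun i ↦
      h.ext_indTrivial_eq_zero _ hq.ne _) fun q hq ↦ by omega
  | succ q ih =>
    obtain ⟨U, hU, f, hf⟩ := hA.exists_cover (s := Set.univ) fun _ _ h ↦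
      SetLike.coe_injective (Set.univ_subset_iff.1 h)
    refine Ext.eq_zero_of_mk₀_comp_eq_zero f x (Ext.eq_zero_of_sigma _ fun i ↦
      h.ext_indTrivial_eq_zero _ hq.ne _) fun q' hq' y ↦ ?_
    obtain rfl : q' = q := by omega
    exact ih ((isSmooth_sigma hK _ fun i ↦ isSmooth_indTrivial hK _).of_mono (kernel.ι f))
      (by omega) y

/-- The obstruction to injectivity is Ext of the kernel in degree n - 1, and that kernel is smooth.
-/
lemma ProjectiveCohomologyConcentrated.eq_zero_of_epi
    (h : ProjectiveCohomologyConcentrated k K n) (hK : K.IsNearNormal)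
    {A B : Rep.{0} k G} (hA : IsSmooth K A) (f : A ⟶ B) [Epi f]
    {P : Rep.{0} k G} [Projective P] (x : Abelian.Ext B P n)
    (hx : (Ext.mk₀ f).comp x (zero_add n) = 0) : x = 0 :=
  Ext.eq_zero_of_mk₀_comp_eq_zero f x hx fun _ hq y ↦
    h.ext_eq_zero_of_isSmooth hK (hA.of_mono (kernel.ι f)) (by omega) y

lemma ProjectiveCohomologyConcentrated.eq_zero_of_res
    (h : ProjectiveCohomologyConcentrated k K n) (hK : K.IsNearNormal)
    (U : Subgroup K) [U.FiniteIndex] {P : Rep.{0} k G} [Projective P]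
    (x : Abelian.Ext (trivial k G k) P n)
    (hx : x.mapExactFunctor (resFunctor.{0} (k := k) (K.subtype.comp U.subtype)) = 0) :
    x = 0 := by
  have := indFunctor_preservesFiniteLimits (k := k) _ (subtype_comp_subtype_injective U)
  exact h.eq_zero_of_epi hK (isSmooth_indTrivial hK U) _ x
    (Ext.counit_comp_eq_zero (indResAdjunction.{0} k (K.subtype.comp U.subtype)) x hx)

end Vanishing

/-! ### Vanishing in degree n by translating supports. -/

section Conjugation

variable {K : Subgroup G}

open scoped Pointwise

/-- Conjugation by `g⁻¹`, as a homomorphism `K ⊓ g K g⁻¹ → K`. -/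
def conjHom (K : Subgroup G) (g : G) :
    ((ConjAct.toConjAct g • K).subgroupOf K : Subgroup K) →* K where
  toFun u := ⟨g⁻¹ * u * g, by
    have := u.2
    rwa [Subgroup.mem_subgroupOf, Subgroup.mem_pointwise_smul_iff_inv_smul_mem,
      ← ConjAct.toConjAct_inv, ConjAct.toConjAct_smul, inv_inv] at this⟩
  map_one' := by ext; simp
  map_mul' u v := by ext; simp [mul_assoc]

/-- The action of `g`, as a natural transformation between restriction functors. -/
def conjNatTrans (k : Type) [CommRing k] (K : Subgroup G) (g : G) :
    resFunctor.{0} (k := k) K.subtype ⋙ resFunctor.{0} (k := k) (conjHom K g) ⟶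
      resFunctor.{0} (k := k) K.subtype ⋙ resFunctor.{0} (k := k)
        ((ConjAct.toConjAct g • K).subgroupOf K).subtype where
  app A := Rep.ofHom ⟨A.ρ g, fun u ↦ by
    ext a
    change A.ρ g (A.ρ (g⁻¹ * u * g) a) = A.ρ u (A.ρ g a)
    simp only [← Module.End.mul_apply, ← map_mul]
    congr 2
    group⟩
  naturality A B f := by
    ext a
    exact (hom_comm_apply f g a).symm

lemma filterHom_conj_comp_eq_zero {α : Type} {S : Set (G × α)} (hS : IsInvariant K.subtype S)
    {g : G} (hg : ∀ y ∈ S, (g⁻¹ * y.1, y.2) ∉ S) :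
    (resFunctor.{0} (k := k) (conjHom K g)).map (filterHom (k := k) K.subtype S hS) ≫
      (conjNatTrans k K g).app (freeOn k G α) ≫
      (resFunctor.{0} (k := k) ((ConjAct.toConjAct g • K).subgroupOf K).subtype).map
        (filterHom K.subtype S hS) = 0 := by
  classical
  refine Rep.hom_ext (IntertwiningMap.ext (LinearMap.ext fun (x : (G × α) →₀ k) ↦ ?_))
  change ((freeOn k G α).ρ g (x.filter (· ∈ S)) : (G × α) →₀ k).filter (· ∈ S) = 0
  ext y
  by_cases hy : y ∈ S
  · rw [Finsupp.filter_apply_pos _ _ hy, freeOn_ρ_apply, Finsupp.filter_apply_neg _ _ (hg y hy)]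
    rfl
  · rw [Finsupp.filter_apply_neg _ _ hy]
    rfl

end Conjugation

section Vanishing

open scoped Pointwise

variable {K : Subgroup G} {n : ℕ}

theorem ProjectiveCohomologyConcentrated.ext_freeOn_eq_zero
    (h : ProjectiveCohomologyConcentrated k K n) (hK : K.IsNearNormal)
    (hindex : ¬ K.FiniteIndex) (hFP : IsFPn n (trivial k K k)) {α : Type}
    (x : Abelian.Ext (trivial k G k) (freeOn k G α) n) : x = 0 := by
  obtain ⟨T, hT, hsupp⟩ := IsFPn.exists_finite_support K.subtype α (A := trivial k K k) hFP
    (x.mapExactFunctor (resFunctor.{0} (k := k) K.subtype))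
  let S : Set (G × α) := {y | ∃ a : K, ((a : G) * y.1, y.2) ∈ T}
  have hS : IsInvariant K.subtype S := fun b y ↦
    ⟨fun ⟨a, ha⟩ ↦ ⟨a * b, by simpa [mul_assoc] using ha⟩,
      fun ⟨a, ha⟩ ↦ ⟨a * b⁻¹, by simpa [mul_assoc] using ha⟩⟩
  obtain ⟨g, hg⟩ := hK.exists_disjoint_translate hindex hT
  have hgS : ∀ y ∈ S, (g⁻¹ * y.1, y.2) ∉ S := by
    rintro y ⟨b, hb⟩ ⟨a, ha⟩
    refine hg _ ha _ hb a⁻¹ b⁻¹ ?_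
    simp
  have : ((ConjAct.toConjAct g • K).subgroupOf K).FiniteIndex :=
    ⟨hK.relIndex_conj_ne_zero (U := K) (by simp) g⟩
  exact h.eq_zero_of_res hK ((ConjAct.toConjAct g • K).subgroupOf K) x
    (Ext.mapExactFunctor_eq_zero_of_natTrans (conjNatTrans k K g) x (filterHom K.subtype S hS)
      (hsupp S hS fun y hy ↦ ⟨1, by simpa using hy⟩)
      -- On the trivial module g acts as the identity, so the identity splits the natural
      -- transformation.
      (Rep.ofHom ⟨LinearMap.id, fun _ ↦ rfl⟩) rfl (filterHom_conj_comp_eq_zero hS hgS))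

end Vanishing

/-! ### Finite support in degree n+1. -/

section TopDegree

variable {K : Subgroup G} {n : ℕ}

/-- `filterHom` for a subset invariant under all of `G`, as an endomorphism of `freeOn k G α`. -/
noncomputable def filterEnd {α : Type} (S : Set (G × α)) (hS : IsInvariant (MonoidHom.id G) S) :
    freeOn k G α ⟶ freeOn k G α :=
  filterHom (MonoidHom.id G) S hS

section Retract

variable {α : Type} (β : Set α)

variable (k G) in
/-- The inclusion of free representations induced by an inclusion of bases. -/
noncomputable def freeOnIncl : freeOn k G β ⟶ freeOn k G α :=
  freeOnLift fun a ↦ Finsupp.single (1, (a : α)) (1 : k)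

open Classical in
variable (k G) in
/-- The retraction of `freeOnIncl` that kills the remaining basis vectors. -/
noncomputable def freeOnProj : freeOn k G α ⟶ freeOn k G β :=
  freeOnLift fun a ↦
    if ha : a ∈ β then Finsupp.single (1, ⟨a, ha⟩) (1 : k) else (0 : (G × β) →₀ k)

lemma isInvariant_snd : IsInvariant (MonoidHom.id G) {y : G × α | y.2 ∈ β} :=
  fun _ _ ↦ Iff.rfl

lemma freeOnProj_comp_freeOnIncl :
    freeOnProj k G β ≫ freeOnIncl k G β = filterEnd _ (isInvariant_snd β) := by
  classical
  refine freeOn_hom_ext fun a ↦ ?_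
  change (freeOnIncl k G β).hom ((freeOnProj k G β).hom (Finsupp.single (1, a) 1)) =
    (Finsupp.single (1, a) (1 : k)).filter (· ∈ {y : G × α | y.2 ∈ β})
  rw [freeOnProj, freeOnLift_one]
  by_cases ha : a ∈ β
  · rw [dif_pos ha, freeOnIncl, freeOnLift_one, Finsupp.filter_single_of_pos _ (by exact ha)]
  · rw [dif_neg ha, Finsupp.filter_single_of_neg _ (by exact ha)]
    exact map_zero (freeOnIncl k G β).hom

lemma IsFG.exists_finite_basis {A : Rep.{0} k G} (hA : IsFG A) (f : A ⟶ freeOn k G α) :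
    ∃ β : Set α, β.Finite ∧ f ≫ freeOnProj k G β ≫ freeOnIncl k G β = f := by
  obtain ⟨T, hT, h⟩ := IsFPn.exists_finite_support (n := 0) (MonoidHom.id G) α hA (Ext.mk₀ f)
  refine ⟨Prod.snd '' T, hT.image _, ?_⟩
  have := h _ (isInvariant_snd (Prod.snd '' T)) fun y hy ↦ ⟨y, hy, rfl⟩
  rw [Ext.mk₀_comp_mk₀] at this
  rw [freeOnProj_comp_freeOnIncl]
  exact (Ext.mk₀_bijective _ _).1 this

end Retract

variable (k) in
/-- The augmentation of `indTrivial k K U`. -/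
noncomputable def indTrivialAug (U : Subgroup K) : indTrivial k K U ⟶ trivial k G k :=
  indTrivialLift U (1 : k) fun _ _ ↦ rfl

lemma indTrivialAug_mk (U : Subgroup K) :
    (indTrivialAug k U).hom (IndV.mk _ _ 1 (1 : k)) = (1 : k) :=
  indTrivialLift_mk _ _ _

instance indTrivialAug_epi (U : Subgroup K) : Epi (indTrivialAug k U) :=
  (epi_iff_surjective _).2 fun (r : k) ↦ ⟨r • IndV.mk _ _ 1 (1 : k),
    ((indTrivialAug k U).hom.toLinearMap.map_smul r _).trans
      ((congr_arg (fun t : k ↦ r • t) (indTrivialAug_mk U)).trans (mul_one r))⟩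

/-- `A` itself is not known to be FP_n, but a finite coproduct of FP_n permutation modules covers
it, and Ext^n injects along that cover. -/
theorem ProjectiveCohomologyConcentrated.exists_finite_support
    (h : ProjectiveCohomologyConcentrated k K n) (hK : K.IsNearNormal)
    (hFP : IsFPn n (trivial k K k)) {A : Rep.{0} k G} (hA : IsSmooth K A) (hA' : IsFG A)
    {α : Type} (x : Abelian.Ext A (freeOn k G α) n) :
    ∃ T : Set (G × α), T.Finite ∧ ∀ (S : Set (G × α)) (hS : IsInvariant (MonoidHom.id G) S),
      T ⊆ S → x.comp (Ext.mk₀ (filterEnd S hS)) (add_zero n) = x := by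
  obtain ⟨s, hs, hgen⟩ := hA'
  obtain ⟨U, hU, f, hf⟩ := hA.exists_cover hgen
  have : Finite s := hs
  have key (a : s) := IsFPn.exists_finite_support (MonoidHom.id G) α
    (((hFP.res (U a)).ind (subtype_comp_subtype_injective (U a)) :
      IsFPn n (indTrivial k K (U a))))
    ((Ext.mk₀ (Limits.Sigma.ι (fun a ↦ indTrivial k K (U a)) a ≫ f)).comp x (zero_add n))
  choose T hT hsupp using key
  refine ⟨⋃ a, T a, Set.finite_iUnion hT, fun S hS hTS ↦ ?_⟩
  rw [← sub_eq_zero]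
  refine h.eq_zero_of_epi hK (isSmooth_sigma hK _ fun i ↦ isSmooth_indTrivial hK _) f _
    (Ext.eq_zero_of_sigma _ fun a ↦ ?_)
  have : ((Ext.mk₀ (Limits.Sigma.ι (fun a ↦ indTrivial k K (U a)) a ≫ f)).comp x
      (zero_add n)).comp (Ext.mk₀ (filterEnd S hS)) (add_zero n) = _ :=
    hsupp a S hS ((Set.subset_iUnion T a).trans hTS)
  rw [Ext.comp_assoc_of_third_deg_zero] at this
  rw [Ext.mk₀_comp_mk₀_assoc, sub_eq_add_neg, Ext.comp_add, Ext.comp_neg, ← sub_eq_add_neg,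
    sub_eq_zero]
  exact this

/-- The differences `e y - e 1`, for y in a finite generating set of `G`, generate the kernel: the x
with `e x - e 1` in their span form a subgroup. -/
lemma isFG_kernel_indTrivialAug [Group.FG G] (U : Subgroup K) :
    IsFG (kernel (indTrivialAug k U)) := by
  set ε := indTrivialAug k U
  let e (x : G) : indTrivial k K U := IndV.mk _ _ x (1 : k)
  have hρ (g x : G) : (indTrivial k K U).ρ g (e x) = e (x * g⁻¹) := by
    rw [of_ρ, ind_mk]
  have hε1 : ε.hom (e 1) = (1 : k) := indTrivialAug_mk U
  have hε (x : G) : ε.hom (e x) = (1 : k) := by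
    have h1 : e x = (indTrivial k K U).ρ x⁻¹ (e 1) := by rw [hρ]; simp
    rw [h1, hom_comm_apply, hε1]
    rfl
  have hε' (v : indTrivial k K U) (hv : ε.hom v = 0) : ∃ z, (kernel.ι ε).hom z = v :=
    (exact_iff_apply _).1 (Ext.shortExact_kernel_of_epi ε).exact v hv
  have hker (x : G) : ∃ z, (kernel.ι ε).hom z = e x - e 1 :=
    hε' _ (by rw [map_sub, hε, hε, sub_self])
  choose z hz using hker
  obtain ⟨s, hs⟩ := Group.FG.out (G := G)
  refine ⟨z '' s, s.finite_toSet.image _, fun W hW hsW ↦ ?_⟩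
  let W' : Submodule k (indTrivial k K U) := W.map (kernel.ι ε).hom.toLinearMap
  have hW' (g : G) (v : indTrivial k K U) (hv : v ∈ W') : (indTrivial k K U).ρ g v ∈ W' := by
    obtain ⟨w, hw, rfl⟩ := hv
    exact ⟨_, hW g w hw, hom_comm_apply (kernel.ι ε) g w⟩
  let N : Subgroup G :=
    { carrier := {x | e x - e 1 ∈ W'}
      one_mem' := by simp
      mul_mem' := fun {x y} hx hy ↦ by
        have := hW' y⁻¹ _ hx
        rw [map_sub, hρ, hρ, inv_inv, one_mul] at this
        simpa using W'.add_mem this hy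
      inv_mem' := fun {x} hx ↦ by
        have := hW' x _ hx
        rw [map_sub, hρ, hρ, one_mul, mul_inv_cancel] at this
        simpa using W'.neg_mem this }
  have hN (x : G) : e x - e 1 ∈ W' := by
    have : N = ⊤ := by
      rw [eq_top_iff, ← hs, Subgroup.closure_le]
      exact fun y hy ↦ ⟨z y, hsW ⟨y, hy, rfl⟩, hz y⟩
    exact (this ▸ Subgroup.mem_top x : x ∈ N)
  have hall : W'.comap (LinearMap.id - (LinearMap.toSpanSingleton k _ (e 1)) ∘ₗ
      (ε.hom.toLinearMap : _ →ₗ[k] k)) = ⊤ := by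
    refine indV_induction _ fun x (a : k) ↦ ?_
    have hxa : IndV.mk (K.subtype.comp U.subtype)
        (res (K.subtype.comp U.subtype) (trivial k G k)).ρ x a = a • e x := by
      rw [← map_smul]
      exact congr_arg _ (mul_one a).symm
    rw [hxa]
    refine Submodule.smul_mem _ _ ?_
    have : e x - (ε.hom (e x) : k) • e 1 ∈ W' := by
      rw [hε, one_smul]
      exact hN x
    exact this
  rw [eq_top_iff]
  rintro w -
  have hw : (kernel.ι ε).hom w ∈ W'.comap (LinearMap.id -
      (LinearMap.toSpanSingleton k _ (e 1)) ∘ₗ (ε.hom.toLinearMap : _ →ₗ[k] k)) :=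
    hall ▸ Submodule.mem_top
  have hw0 : (ε.hom ((kernel.ι ε).hom w) : k) = 0 :=
    congr_arg (fun f ↦ f.hom w) (kernel.condition ε)
  have hw1 : (kernel.ι ε).hom w - (ε.hom ((kernel.ι ε).hom w) : k) • e 1 ∈ W' := hw
  rw [hw0, zero_smul, sub_zero] at hw1
  obtain ⟨w', hw', e'⟩ := hw1
  rwa [← (mono_iff_injective (kernel.ι ε)).1 inferInstance e']

theorem ProjectiveCohomologyConcentrated.exists_freeOn_comp_eq [Group.FG G]
    (h : ProjectiveCohomologyConcentrated k K n) (hK : K.IsNearNormal)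
    (hFP : IsFPn n (trivial k K k)) {α : Type}
    (x : Abelian.Ext (trivial k G k) (freeOn k G α) (n + 1)) :
    ∃ (β : Type) (_ : Finite β) (f : freeOn k G β ⟶ freeOn k G α)
      (x₀ : Abelian.Ext (trivial k G k) (freeOn k G β) (n + 1)),
      x₀.comp (Ext.mk₀ f) (add_zero _) = x := by
  let ε := indTrivialAug k (⊤ : Subgroup K)
  obtain ⟨x', rfl⟩ := Ext.contravariant_sequence_exact₃ (Ext.shortExact_kernel_of_epi ε) _ x
    (h.ext_indTrivial_eq_zero _ (by omega) _) (add_comm 1 n)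
  obtain ⟨T, hT, hsupp⟩ := h.exists_finite_support hK hFP
    ((isSmooth_indTrivial hK (⊤ : Subgroup K)).of_mono (kernel.ι ε))
    (isFG_kernel_indTrivialAug ⊤) x'
  refine ⟨Prod.snd '' T, hT.image _, freeOnIncl k G _,
    ((Ext.shortExact_kernel_of_epi ε).extClass.comp x' (add_comm 1 n)).comp
      (Ext.mk₀ (freeOnProj k G _)) (add_zero _), ?_⟩
  rw [Ext.comp_assoc_of_third_deg_zero, Ext.mk₀_comp_mk₀, Ext.comp_assoc_of_third_deg_zero,
    freeOnProj_comp_freeOnIncl, hsupp _ (isInvariant_snd (Prod.snd '' T)) fun y hy ↦ ⟨y, hy, rfl⟩]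

end TopDegree

end Rep

/-! ### Splicing projective resolutions. -/

namespace CategoryTheory.ProjectiveResolution

open Limits

universe v u₀

variable {C : Type u₀} [Category.{v} C] [Abelian C]

/-- The augmentation of a projective resolution. -/
noncomputable def aug {Z : C} (P : ProjectiveResolution Z) : P.complex.X 0 ⟶ Z := P.π.f 0

lemma d_comp_aug {Z : C} (P : ProjectiveResolution Z) : P.complex.d 1 0 ≫ P.aug = 0 :=
  P.complex_d_comp_π_f_zero

lemma exact_aug {Z : C} (P : ProjectiveResolution Z) : (ShortComplex.mk _ _ P.d_comp_aug).Exact :=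
  P.exact₀

instance epi_aug {Z : C} (P : ProjectiveResolution Z) : Epi P.aug :=
  inferInstanceAs (Epi (P.π.f 0))

lemma exact_aug_comp {S : ShortComplex C} (hS : S.ShortExact) (P : ProjectiveResolution S.X₁) :
    (ShortComplex.mk (P.aug ≫ S.f) S.g (by rw [Category.assoc, S.zero, comp_zero])).Exact := by
  have h := hS.exact
  rw [ShortComplex.exact_iff_exact_up_to_refinements] at h ⊢
  intro X x hx
  obtain ⟨X', π, hπ, y, hy⟩ := h x hx
  have : Epi (pullback.fst y P.aug ≫ π) := epi_comp _ _
  refine ⟨pullback y P.aug, pullback.fst _ _ ≫ π, inferInstance, pullback.snd _ _, ?_⟩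
  dsimp only at hy ⊢
  rw [Category.assoc, hy, ← Category.assoc, ← Category.assoc, pullback.condition]

lemma exact_comp_aug {S : ShortComplex C} (hS : S.ShortExact) (P : ProjectiveResolution S.X₁) :
    (ShortComplex.mk (P.complex.d 1 0) (P.aug ≫ S.f)
      (by rw [← Category.assoc, P.d_comp_aug, zero_comp])).Exact := by
  have := hS.mono_f
  have h := P.exact_aug
  rw [ShortComplex.exact_iff_exact_up_to_refinements] at h ⊢
  intro X x hx
  refine h x ?_
  rw [← cancel_mono S.f, zero_comp, Category.assoc]
  exact hx

lemma quasiIso_to_single₀ {K : ChainComplex C ℕ} {X : C} (φ : K ⟶ (ChainComplex.single₀ C).obj X)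
    (f : K.X 0 ⟶ X) (hf' : Epi f) (hf : φ.f 0 = f) (w : K.d 1 0 ≫ f = 0)
    (h : (ShortComplex.mk _ _ w).Exact) (hK : ∀ i, K.ExactAt (i + 1)) : QuasiIso φ := by
  refine ⟨fun i ↦ ?_⟩
  cases i with
  | zero =>
    rw [ChainComplex.quasiIsoAt₀_iff, ShortComplex.quasiIso_iff_of_zeros']
    · refine (ShortComplex.exact_and_epi_g_iff_of_iso ?_).2 ⟨h, hf'⟩
      subst hf
      exact ShortComplex.isoMk (Iso.refl _) (Iso.refl _) (Iso.refl _)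
        ((Category.id_comp _).trans (Category.comp_id _).symm)
        ((Category.id_comp _).trans (Category.comp_id _).symm)
    all_goals first | rfl | exact K.shape 0 0 (by simp)
  | succ i =>
    rw [quasiIsoAt_iff_exactAt' _ _ (ChainComplex.exactAt_succ_single_obj _ _)]
    exact hK i

/-- The projective resolution of the last term of a short exact sequence obtained from one of the
first term, if the middle term is projective. -/
noncomputable def splice {S : ShortComplex C} (hS : S.ShortExact) [Projective S.X₂]
    (P : ProjectiveResolution S.X₁) : ProjectiveResolution S.X₃ where
  complex := P.complex.augment (P.aug ≫ S.f)
    (by rw [← Category.assoc, P.d_comp_aug, zero_comp])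
  projective i := by
    cases i with
    | zero => exact inferInstanceAs (Projective S.X₂)
    | succ i => exact P.projective i
  π := (ChainComplex.toSingle₀Equiv _ _).symm ⟨S.g, by
    change (P.aug ≫ S.f) ≫ S.g = 0
    rw [Category.assoc, S.zero, comp_zero]⟩
  quasiIso := by
    refine quasiIso_to_single₀ _ S.g hS.epi_g (ChainComplex.toSingle₀Equiv_symm_apply_f_zero _ _) _
      (exact_aug_comp hS P) fun i ↦ ?_
    cases i with
    | zero =>
      rw [HomologicalComplex.exactAt_iff' _ 2 1 0 (by simp) (by simp)]
      exact exact_comp_aug hS P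
    | succ i =>
      rw [HomologicalComplex.exactAt_iff' _ (i + 3) (i + 2) (i + 1) (by simp) (by simp)]
      exact P.exact_succ i

end CategoryTheory.ProjectiveResolution

namespace Rep

open Limits Representation CategoryTheory.Abelian

variable {k : Type} [CommRing k] {G : Type} [Group G]

/-! ### Translating between resolutions, FP and syzygies. -/

section Resolutions

lemma IsFG.of_isZero {A : Rep.{0} k G} (hA : IsZero A) : IsFG A := by
  have : Epi (0 : freeOn k G Empty ⟶ A) := ⟨fun _ _ _ ↦ hA.eq_of_src _ _⟩
  exact (isFG_freeOn Empty).of_epi 0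

/-- A representation has a resolution of length `d` by finitely generated projectives. -/
def HasFiniteResolution : ℕ → Rep.{0} k G → Prop
  | 0, A => Projective A ∧ IsFG A
  | d + 1, A => ∃ (A' P : Rep.{0} k G) (i : A' ⟶ P) (p : P ⟶ A) (w : i ≫ p = 0),
      (ShortComplex.mk i p w).ShortExact ∧ Projective P ∧ IsFG P ∧ HasFiniteResolution d A'

lemma HasFiniteResolution.exists_projectiveResolution {d : ℕ} {A : Rep.{0} k G}
    (hA : HasFiniteResolution d A) :
    ∃ P : ProjectiveResolution A, (∀ i, IsFG (P.complex.X i)) ∧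
      ∀ i, d < i → IsZero (P.complex.X i) := by
  induction d generalizing A with
  | zero =>
    obtain ⟨h, h'⟩ := hA
    have hz (i : ℕ) (hi : 0 < i) : IsZero ((ProjectiveResolution.self A).complex.X i) :=
      HomologicalComplex.isZero_single_obj_X _ _ _ _ hi.ne'
    refine ⟨ProjectiveResolution.self A, fun i ↦ ?_, hz⟩
    cases i with
    | zero => exact h'
    | succ i => exact IsFG.of_isZero (hz _ i.succ_pos)
  | succ d ih =>
    obtain ⟨A', P, i, p, w, hS, hP, hP', hA'⟩ := hA
    obtain ⟨Q, hQ, hQ'⟩ := ih hA'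
    have : Projective (ShortComplex.mk i p w).X₂ := hP
    refine ⟨ProjectiveResolution.splice hS Q, fun i ↦ ?_, fun i hi ↦ ?_⟩
    · cases i with
      | zero => exact hP'
      | succ i => exact hQ i
    · cases i with
      | zero => omega
      | succ i => exact hQ' i (by omega)

lemma isFPn_of_projectiveResolution {A : Rep.{0} k G} (P : ProjectiveResolution A)
    (hP : ∀ i, IsFG (P.complex.X i)) {n i : ℕ} {B : Rep.{0} k G} (p : P.complex.X i ⟶ B) [Epi p]
    (w : P.complex.d (i + 1) i ≫ p = 0) (h : (ShortComplex.mk _ _ w).Exact) : IsFPn n B := by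
  induction n generalizing i B with
  | zero => exact (hP i).of_epi p
  | succ n ih =>
    have : Epi (kernel.lift p _ w) := h.epi_kernelLift
    refine ⟨kernel p, P.complex.X i, kernel.ι p, p, kernel.condition p,
      Ext.shortExact_kernel_of_epi p, P.projective i, hP i, ih (kernel.lift p _ w) ?_ ?_⟩
    · rw [← cancel_mono (kernel.ι p)]
      simp
    · rw [exact_iff_apply]
      intro x hx
      refine (exact_iff_apply _).1 (P.exact_succ i) x ?_
      have := congr_arg (fun f ↦ f.hom x) (kernel.lift_ι p _ w)
      refine this.symm.trans ?_
      exact (congr_arg (kernel.ι p).hom hx).trans (map_zero _)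

lemma isFPn_trivial_of_isTypeFP (h : IsTypeFP k G) (n : ℕ) : IsFPn n (trivial k G k) := by
  obtain ⟨P, hP, -⟩ := h
  exact isFPn_of_projectiveResolution P (fun i ↦ (isFG_iff_finite _).2 (hP i)) P.aug _ P.exact_aug

lemma HasFiniteResolution.isTypeFP {d : ℕ} (h : HasFiniteResolution d (trivial k G k)) :
    IsTypeFP k G := by
  obtain ⟨P, hP, hP'⟩ := h.exists_projectiveResolution
  exact ⟨P, fun i ↦ (isFG_iff_finite _).1 (hP i), d, hP'⟩

lemma ext_eq_zero_of_cohomologicalDimensionLE {d m : ℕ} (h : CohomologicalDimensionLE k G d)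
    (hm : d < m) {M : Rep.{0} k G} (x : Abelian.Ext (trivial k G k) M m) : x = 0 := by
  obtain ⟨P, hP⟩ := h
  obtain ⟨f, hf, rfl⟩ := P.extMk_surjective x (m + 1) rfl
  obtain rfl : f = 0 := (hP m hm).eq_of_src _ _
  exact P.extMk_zero _ _

end Resolutions

/-! ### A cohomological criterion for finite resolutions. -/

section Factorization

lemma isFG_trivial : IsFG (trivial k G k) := by
  refine ⟨{(1 : k)}, Set.finite_singleton _, fun W _ h ↦ ?_⟩
  rw [eq_top_iff]
  rintro (r : k) -
  have := W.smul_mem r (h rfl)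
  have e : r • (1 : k) = r := mul_one r
  exact e ▸ this

/-- Every class of degree `m` with source `A` comes from a class with finitely generated target. -/
def ExtFactorsThroughFG (A : Rep.{0} k G) (m : ℕ) : Prop :=
  ∀ (M : Rep.{0} k G) (c : Abelian.Ext A M m), ∃ (M₀ : Rep.{0} k G) (_ : IsFG M₀) (f : M₀ ⟶ M)
    (c₀ : Abelian.Ext A M₀ m), c₀.comp (Ext.mk₀ f) (add_zero m) = c

variable {A : Rep.{0} k G}

lemma extFactorsThroughFG_of_freeOn {m : ℕ}
    (h : ∀ (M : Rep.{0} k G) (x : Abelian.Ext A M (m + 1)), x = 0)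
    (h' : ∀ (α : Type) (x : Abelian.Ext A (freeOn k G α) m), ∃ (β : Type) (_ : Finite β)
      (f : freeOn k G β ⟶ freeOn k G α) (x₀ : Abelian.Ext A (freeOn k G β) m),
      x₀.comp (Ext.mk₀ f) (add_zero _) = x) : ExtFactorsThroughFG A m := by
  intro M c
  have := freeOnLift_epi (A := M)
  obtain ⟨x, rfl⟩ := Ext.covariant_sequence_exact₃ A
    (Ext.shortExact_kernel_of_epi (freeOnLift (id : M → M))) c rfl (h _ _)
  obtain ⟨β, hβ, f, x₀, rfl⟩ := h' _ x
  refine ⟨_, isFG_freeOn β, f ≫ freeOnLift id, x₀, ?_⟩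
  rw [Ext.comp_assoc_of_third_deg_zero, Ext.mk₀_comp_mk₀]

/-- The boundary of `c` in a free presentation of `M` comes from a finitely generated submodule of
the relations. These relations involve finitely many generators, so they present a finitely
generated module mapping to `M`. -/
lemma ExtFactorsThroughFG.of_succ {m : ℕ} (h : ExtFactorsThroughFG A (m + 1))
    (h' : ∀ (α : Type) (x : Abelian.Ext A (freeOn k G α) m), x = 0) :
    ExtFactorsThroughFG A m := by
  intro M c
  have := freeOnLift_epi (A := M)
  set p := freeOnLift (id : M → M)
  have hS := Ext.shortExact_kernel_of_epi p
  obtain ⟨N, hN, f, c', hc'⟩ := h _ (c.comp hS.extClass rfl)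
  have hR : IsFG (Abelian.image f) := hN.of_epi (Abelian.factorThruImage f)
  obtain ⟨β, hβ, hj⟩ := hR.exists_finite_basis (Abelian.image.ι f ≫ kernel.ι p)
  have : Finite β := hβ
  set i := freeOnIncl k G β
  set r := freeOnProj k G β
  have hj' : ((Abelian.image.ι f ≫ kernel.ι p) ≫ r) ≫ i = Abelian.image.ι f ≫ kernel.ι p := by
    rw [Category.assoc, hj]
  set j := (Abelian.image.ι f ≫ kernel.ι p) ≫ r with hjdef
  have : Mono j := mono_of_mono_fac hj'
  have hS₀ : (ShortComplex.mk j (cokernel.π j) (cokernel.condition j)).ShortExact :=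
    { exact := ShortComplex.exact_cokernel j
      mono_f := inferInstance
      epi_g := inferInstance }
  let g : cokernel j ⟶ M := cokernel.desc j (i ≫ p) (by
    rw [← Category.assoc, hj', Category.assoc, kernel.condition, comp_zero])
  have nat := ShortComplex.ShortExact.extClass_naturality hS₀ hS
    { τ₁ := Abelian.image.ι f
      τ₂ := i
      τ₃ := g
      comm₁₂ := hj'.symm
      comm₂₃ := (cokernel.π_desc _ _ _).symm }
  dsimp only at nat
  set c₀ := c'.comp (Ext.mk₀ (Abelian.factorThruImage f)) (add_zero _)
  have hc₀ : c₀.comp (Ext.mk₀ (Abelian.image.ι f)) (add_zero _) = c.comp hS.extClass rfl := by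
    rw [Ext.comp_assoc_of_third_deg_zero, Ext.mk₀_comp_mk₀, Abelian.image.fac, hc']
  -- Along `j`, `c₀` becomes a boundary pushed into the free middle term, hence zero; so `c₀` is
  -- itself a boundary.
  obtain ⟨c₁, hc₁⟩ := Ext.covariant_sequence_exact₁ A hS₀ c₀ (by
    change c₀.comp (Ext.mk₀ j) _ = 0
    rw [hjdef, ← Ext.mk₀_comp_mk₀, ← Ext.mk₀_comp_mk₀,
      ← Ext.comp_assoc_of_third_deg_zero, ← Ext.comp_assoc_of_third_deg_zero, hc₀,
      Ext.comp_assoc c hS.extClass _ rfl rfl rfl]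
    erw [hS.extClass_comp]
    simp) rfl
  -- `c` and the image of `c₁` have equal boundaries, so they differ by a class from the free
  -- module, which vanishes by `h'`.
  obtain ⟨x, hx⟩ := Ext.covariant_sequence_exact₃ A hS
    (c - c₁.comp (Ext.mk₀ g) (add_zero m)) rfl (by
      rw [sub_eq_add_neg, Ext.add_comp, Ext.neg_comp, ← sub_eq_add_neg, sub_eq_zero,
        Ext.comp_assoc_of_second_deg_zero, ← nat, ← hc₀, ← hc₁,
        Ext.comp_assoc_of_third_deg_zero])
  refine ⟨_, (isFG_freeOn β).of_epi (cokernel.π j), g, c₁, ?_⟩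
  rw [h' _ x, Ext.zero_comp] at hx
  exact (sub_eq_zero.1 hx.symm).symm

/-- If the extension class comes from `f`, it dies in the cokernel of `f`. The projection onto this
cokernel then extends to `S.X₂`, so both the image and the cokernel of `f` are finitely generated.
-/
lemma ExtFactorsThroughFG.isFG_of_shortExact {S : ShortComplex (Rep.{0} k G)} (hS : S.ShortExact)
    (h : ExtFactorsThroughFG S.X₃ 1) (h₂ : IsFG S.X₂) : IsFG S.X₁ := by
  obtain ⟨M, hM, f, c, hc⟩ := h _ hS.extClass
  have h1 : hS.extClass.comp (Ext.mk₀ (cokernel.π f)) (add_zero 1) = 0 := by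
    rw [← hc, Ext.comp_assoc_of_third_deg_zero, Ext.mk₀_comp_mk₀, cokernel.condition]
    simp
  obtain ⟨y, hy⟩ := Ext.contravariant_sequence_exact₁ hS _ (Ext.mk₀ (cokernel.π f)) (add_zero 1) h1
  obtain ⟨q, rfl⟩ := (Ext.mk₀_bijective _ _).2 y
  rw [Ext.mk₀_comp_mk₀] at hy
  have hq : S.f ≫ q = cokernel.π f := (Ext.mk₀_bijective _ _).1 hy
  have : Epi q := epi_of_epi_fac hq
  exact IsFG.of_shortExact (Ext.shortExact_kernel_of_epi (cokernel.π f))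
    (hM.of_epi (Abelian.factorThruImage f)) (h₂.of_epi q)

lemma ExtFactorsThroughFG.of_shortExact {S : ShortComplex (Rep.{0} k G)} (hS : S.ShortExact)
    [Projective S.X₂] {m : ℕ} (h : ExtFactorsThroughFG S.X₃ (m + 2)) :
    ExtFactorsThroughFG S.X₁ (m + 1) := by
  intro M c
  obtain ⟨M₀, hM₀, f, c₀, hc₀⟩ := h _ (hS.extClass.comp c (add_comm 1 (m + 1)))
  obtain ⟨c₁, rfl⟩ := Ext.exists_extClass_comp_eq hS c₀
  refine ⟨M₀, hM₀, f, c₁, ?_⟩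
  rw [Ext.comp_assoc_of_third_deg_zero] at hc₀
  obtain ⟨y, hy⟩ := Ext.contravariant_sequence_exact₁ hS _
    (c₁.comp (Ext.mk₀ f) (add_zero _) - c) (add_comm 1 (m + 1)) (by
      rw [sub_eq_add_neg, Ext.comp_add, Ext.comp_neg, hc₀, add_neg_cancel])
  rw [Ext.eq_zero_of_projective y, Ext.comp_zero] at hy
  exact sub_eq_zero.1 hy.symm

theorem hasFiniteResolution_of_extFactorsThroughFG {N : ℕ} (hA : IsFG A)
    (h : ∀ m, 1 ≤ m → m ≤ N → ExtFactorsThroughFG A m)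
    (h' : ∀ (M : Rep.{0} k G) (x : Abelian.Ext A M (N + 1)), x = 0) :
    HasFiniteResolution N A := by
  induction N generalizing A with
  | zero =>
    refine ⟨projective_iff_subsingleton_ext_one.2 fun M ↦ ⟨fun x y ↦ ?_⟩, hA⟩
    rw [h' M x, h' M y]
  | succ N ih =>
    obtain ⟨α, hα, p, hp⟩ := hA.exists_epi
    have hS := Ext.shortExact_kernel_of_epi p
    have : Projective (ShortComplex.mk (kernel.ι p) p (kernel.condition p)).X₂ :=
      inferInstanceAs (Projective (freeOn k G α))
    refine ⟨kernel p, freeOn k G α, kernel.ι p, p, kernel.condition p, hS, inferInstance,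
      isFG_freeOn α, ih ((h 1 le_rfl (by omega)).isFG_of_shortExact hS (isFG_freeOn α))
        (fun m hm hm' ↦ ?_) fun M x ↦ ?_⟩
    · obtain ⟨m, rfl⟩ := Nat.exists_eq_add_of_le' hm
      exact (h (m + 2) (by omega) (by omega)).of_shortExact hS
    · obtain ⟨y, rfl⟩ := Ext.contravariant_sequence_exact₁ hS M x (add_comm 1 (N + 1)) (h' _ _)
      rw [Ext.eq_zero_of_projective y, Ext.comp_zero]

end Factorization

end Rep

/-! ### From free to projective coefficients, and the conclusion. -/

namespace Rep

open CategoryTheory.Abelian Limits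

variable {k : Type} [CommRing k] {G : Type} [Group G]

lemma ext_projective_eq_zero_of_freeOn {A : Rep.{0} k G} {m : ℕ}
    (h : ∀ (α : Type) (x : Abelian.Ext A (freeOn k G α) m), x = 0) (P : Rep.{0} k G)
    [Projective P] (x : Abelian.Ext A P m) : x = 0 := by
  have := freeOnLift_epi (A := P)
  have e : Projective.factorThru (𝟙 P) (freeOnLift id) ≫ freeOnLift (id : P → P) = 𝟙 P :=
    Projective.factorThru_comp _ _
  rw [← Ext.comp_mk₀_id x, ← e, ← Ext.mk₀_comp_mk₀, ← Ext.comp_assoc_of_third_deg_zero,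
    h _ (x.comp _ _), Ext.zero_comp]

end Rep

theorem mainTheorem7 (n : ℕ) (G : Type) [Group G] (hfg : Group.FG G)
    (hcd : CohomologicalDimensionLE ℤ G (n + 1))
    (K : Subgroup G) (hnear : K.IsNearNormal) (hindex : ¬ K.FiniteIndex)
    (hFP : IsTypeFP ℤ K)
    (hvanish : ∀ P : Rep.{0} ℤ K, Projective P →
      ∀ m : ℕ, m ≠ n → Limits.IsZero (groupCohomology P m)) :
    IsTypeFP ℤ G ∧
      ∀ P : Rep.{0} ℤ G, Projective P →
        ∀ m : ℕ, m ≠ n + 1 → Limits.IsZero (groupCohomology P m) := by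
  have h : Rep.ProjectiveCohomologyConcentrated ℤ K n := fun P hP m hm ↦
    (Rep.isZero_groupCohomology_iff P m).1 (hvanish P hP m hm)
  have hFPn := Rep.isFPn_trivial_of_isTypeFP hFP n
  have hfree (m : ℕ) (hm : m ≤ n) (α : Type)
      (x : Abelian.Ext (Rep.trivial ℤ G ℤ) (Rep.freeOn ℤ G α) m) : x = 0 := by
    obtain hm | rfl := hm.lt_or_eq
    · exact h.ext_eq_zero_of_isSmooth hnear Rep.isSmooth_trivial hm x
    · exact h.ext_freeOn_eq_zero hnear hindex hFPn x
  have hvan (m : ℕ) (hm : n + 1 < m) (M : Rep.{0} ℤ G)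
      (x : Abelian.Ext (Rep.trivial ℤ G ℤ) M m) : x = 0 :=
    Rep.ext_eq_zero_of_cohomologicalDimensionLE hcd hm x
  refine ⟨?_, fun P hP m hm ↦ (Rep.isZero_groupCohomology_iff P m).2 fun x ↦ ?_⟩
  · refine (Rep.hasFiniteResolution_of_extFactorsThroughFG (N := n + 1) Rep.isFG_trivial
      (fun m _ hm ↦ ?_) (hvan _ (by omega))).isTypeFP
    -- Factorization starts in the top degree n+1 and descends through the degrees where free
    -- coefficients have no cohomology.
    induction hm using Nat.decreasingInduction with
    | self =>
      exact Rep.extFactorsThroughFG_of_freeOn (hvan _ (by omega))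
        fun α x ↦ h.exists_freeOn_comp_eq hnear hFPn x
    | of_succ m hm ih => exact (ih (by omega)).of_succ (hfree m (by omega))
  · obtain hm | hm := hm.lt_or_gt
    · exact Rep.ext_projective_eq_zero_of_freeOn (hfree m (by omega)) P x
    · exact hvan m hm P x
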